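/- Logarithms are in base $2$ and $\|\cdot\|$ is a norm on $\mathbb R^{n_x}$. \textbf{Channel.} A causal channel with finite input alphabet $\mathcal X$ and output alphabet $\mathcal Y$ is given by $Y_i=g_i(X_{1:i},Z_{1:i})$, $i\in\mathbb N=\{1,2,\dots\}$, where the noise variable $Z_i$ takes values in a nonempty set and is unrelated to $(X_{1:i},Z_{1:i-1})$, i.e. every value of $Z_i$ may occur together with every value of $(X_{1:i},Z_{1:i-1})$. A uniform zero-error feedback code with $M\ge 1$ messages and block length $n\ge 1$ consists of functions $f_i:\{1,\dots,M\}\times\mathcal Y^{i-1}\to\mathcal X$, $1\le i\le n$, such that for every $t_0\in\mathbb N\cup\{0\}$, if the inputs are $X_{t_0+i}=f_i(m,Y_{t_0+1},\dots,Y_{t_0+i-1})$ for $1\le i\le n$ and the inputs up to time $t_0$ are arbitrary, then two distinct messages $m\ne m'$ never result in the same output block $Y_{t_0+1},\dots,Y_{t_0+n}$. The uniform zero-error feedback capacity $C_{0f}$ is the supremum of $\frac{\log M}{n}$ over all these codes. \textbf{Plant.} Let $X_{t+1}=AX_t+BU_t+V_t\in\mathbb R^{n_x}$, $U_t\in\mathbb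 R^{n_u}$, where $\|V_t\|\le D$ for all $t$, the noise sequence $V_t=0$ for all $t$ is possible, $A$ has an eigenvalue of magnitude greater than one, and $(A,B)$ is stabilizable (the modes of the eigenvalues $\lambda$ with $|\lambda|\ge1$ are controllable). Let $h_{lin}=\sum_{|\lambda_i|\ge 1}\log|\lambda_i|$, the sum over the eigenvalues $\lambda_i$ of $A$ with algebraic multiplicity. Let $l>0$. \textbf{Closed loop.} A coder-controller consists of coding functions $\mu_k:(\mathbb R^{n_x})^k\to\mathcal X$ and control functions $\eta^{t_0}_k:\mathcal Y^k\to\mathbb R^{n_u}$, $k\ge1$, $t_0\in\mathbb N\cup\{0\}$. If plant and channel operation are initialized at time $t_0+1$, the channel input and the control at time $t_0+k$ are $\mu_k(X_{t_0+1},\dots,X_{t_0+k})$ and $U_{t_0+k}=\eta^{t_0}_k(Y_{t_0+1},\dots,Y_{t_0+k})$; there is no other feedback from the channel output to the coder. The initial state $X_{t_0+1}$ is any point of the ball $\{x:\|x\|\le l\}$, and the initial state, the plant noise sequence, the channel noise and the channel inputs before the start are unrelated. As for a uniform code, the coder does not depend on $t_0$, and the controller may use $t_0$ for decoding only: the coder-controller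 is required to be uniform, i.e. there are functions $\kappa_k$ such that $U_{t_0+k}=\kappa_k(X_{t_0+1},\dots,X_{t_0+k},Y_{t_0+1},\dots,Y_{t_0+k})$ in every run of the closed loop, for all $t_0$ and $k$ (for instance, $\eta^{t_0}_k$ does not depend on $t_0$). It keeps the state uniformly bounded if there is a $\varphi<\infty$ such that $\|X_{t_0+k}\|\le\varphi$ for all $t_0\ge0$ and $k\ge1$, all initial states in the ball, all plant and channel noise realizations and all earlier channel inputs. \textbf{Theorem 2 (Bounded stabilization).} If some uniform coder-controller keeps the state uniformly bounded, then $C_{0f}\ge h_{lin}$. Conversely, if $C_{0f}>h_{lin}$, then there is a uniform coder-controller that keeps the state uniformly bounded. -/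

import Mathlib

/-! Time is counted from `0` in the code: index `t` is the mathematical time `t + 1`.
In particular a start index `t₀ : ℕ` is the starting time `t₀ + 1`. -/

/-- A causal channel with input alphabet `𝒳`, output alphabet `𝒴` and noise alphabet `𝒵`.
`noise t` is the range of the noise variable `Z_t`. Since `Z_t` is unrelated to the inputs up to
time `t` and to the earlier noise, every sequence `z` with `z t ∈ noise t` for all `t` may occur,
together with every input sequence. The output at time `t` is a function of the inputs and of the
noise up to time `t`. -/
structure CausalChannel (𝒳 𝒴 𝒵 : Type*) where
  noise : ℕ → Set 𝒵
  noise_nonempty : ∀ t, (noise t).Nonempty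
  out : (t : ℕ) → (Fin (t + 1) → 𝒳) → (Fin (t + 1) → 𝒵) → 𝒴

namespace CausalChannel

variable {𝒳 𝒴 𝒵 : Type*}

/-- The input sequence `x` can result in the output sequence `y`. -/
def IsRun (ch : CausalChannel 𝒳 𝒴 𝒵) (x : ℕ → 𝒳) (y : ℕ → 𝒴) : Prop :=
  ∃ z : ℕ → 𝒵, (∀ t, z t ∈ ch.noise t) ∧
    ∀ t, y t = ch.out t (fun i => x i) (fun i => z i)

/-- Encoding functions of a feedback code with `M` messages and block length `n`: the input number
`i` of the block depends on the message and on the `i` previous outputs of the block. -/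
abbrev FeedbackEncoder (𝒳 𝒴 : Type*) (M n : ℕ) : Type _ :=
  (i : Fin n) → Fin M → (Fin i → 𝒴) → 𝒳

/-- The conditional range of the block of `n` outputs given the message `m`, if the transmission
starts at index `t₀`. The channel inputs before the block are arbitrary. -/
def outputRange (ch : CausalChannel 𝒳 𝒴 𝒵) {M n : ℕ} (f : FeedbackEncoder 𝒳 𝒴 M n)
    (t₀ : ℕ) (m : Fin M) : Set (Fin n → 𝒴) :=
  {w | ∃ (x : ℕ → 𝒳) (y : ℕ → 𝒴), ch.IsRun x y ∧
    (∀ i : Fin n, x (t₀ + i) = f i m (fun j => y (t₀ + j))) ∧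
    ∀ i : Fin n, w i = y (t₀ + i)}

/-- Uniform zero-error feedback codes: for every starting time, distinct messages never result in
the same block of outputs. -/
def IsUniformZeroError (ch : CausalChannel 𝒳 𝒴 𝒵) {M n : ℕ}
    (f : FeedbackEncoder 𝒳 𝒴 M n) : Prop :=
  ∀ t₀ : ℕ, ∀ m m' : Fin M, m ≠ m' →
    Disjoint (ch.outputRange f t₀ m) (ch.outputRange f t₀ m')

/-- The (uniform) zero-error feedback capacity, in bits per channel use. -/
noncomputable def zeroErrorFeedbackCapacity (ch : CausalChannel 𝒳 𝒴 𝒵) : EReal :=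
  sSup {R : EReal | ∃ (n M : ℕ) (f : FeedbackEncoder 𝒳 𝒴 M n), 0 < n ∧ 0 < M ∧
    ch.IsUniformZeroError f ∧ R = ((Real.logb 2 (M : ℝ) / (n : ℝ) : ℝ) : EReal)}

end CausalChannel

/-- The eigenvalues of a real matrix in `ℂ`, repeated according to algebraic multiplicity. -/
noncomputable def complexEigenvalues {n : ℕ} (A : Matrix (Fin n) (Fin n) ℝ) : Multiset ℂ :=
  (A.map Complex.ofReal).charpoly.roots

open Classical in
/-- The topological entropy of the linear system with system matrix `A`. -/
noncomputable def linearEntropy {n : ℕ} (A : Matrix (Fin n) (Fin n) ℝ) : ℝ :=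
  (((complexEigenvalues A).filter (fun z => 1 ≤ ‖z‖)).map (fun z => Real.logb 2 ‖z‖)).sum

/-- The controllable subspace of `(A, B)`, complexified: the span of the ranges of `A ^ k * B`. -/
noncomputable def controllableSubspace {n p : ℕ} (A : Matrix (Fin n) (Fin n) ℝ)
    (B : Matrix (Fin n) (Fin p) ℝ) : Submodule ℂ (Fin n → ℂ) :=
  ⨆ k : ℕ, LinearMap.range ((A ^ k * B).map Complex.ofReal).mulVecLin

/-- `(A, B)` is stabilizable: the unstable modes (the generalized eigenspaces of the eigenvalues
outside the open unit disk) are controllable. -/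
def IsStabilizable {n p : ℕ} (A : Matrix (Fin n) (Fin n) ℝ)
    (B : Matrix (Fin n) (Fin p) ℝ) : Prop :=
  ∀ z : ℂ, 1 ≤ ‖z‖ →
    Module.End.maxGenEigenspace (Matrix.toLin' (A.map Complex.ofReal)) z ≤
      controllableSubspace A B

/-- A linear time-invariant plant `x (t + 1) = A x t + B u t + v t`; `noise` is the set of the
possible noise sequences `v`. -/
structure LinearPlant (n p : ℕ) where
  A : Matrix (Fin n) (Fin n) ℝ
  B : Matrix (Fin n) (Fin p) ℝ
  noise : Set (ℕ → Fin n → ℝ)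

/-- A coder-controller. At step `k` after the start the coder maps the states of the steps
`0, …, k` to a channel input, by a map that does not depend on the starting time `t₀`, and the
controller maps the channel outputs of the steps `0, …, k` to a control. As the decoder of a
uniform code, the controller may use the starting time for decoding. -/
structure CoderController (𝒳 𝒴 : Type*) (n p : ℕ) where
  coder : (k : ℕ) → (Fin (k + 1) → (Fin n → ℝ)) → 𝒳
  controller : (t₀ : ℕ) → (k : ℕ) → (Fin (k + 1) → 𝒴) → (Fin p → ℝ)

namespace CoderController

variable {𝒳 𝒴 𝒵 : Type*} {n p : ℕ}

/-- The closed loop can produce the states `x` and the channel outputs `y`, if it is started at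
index `t₀` in the ball of radius `l`; `x k` is the state `k` steps after the start. The initial
state, the plant noise, the channel noise and the channel inputs before the start are unrelated. -/
def IsClosedLoopRun (cc : CoderController 𝒳 𝒴 n p) (P : LinearPlant n p)
    (ch : CausalChannel 𝒳 𝒴 𝒵) (l : ℝ) (t₀ : ℕ) (x : ℕ → Fin n → ℝ) (y : ℕ → 𝒴) : Prop :=
  ‖x 0‖ ≤ l ∧ ∃ v ∈ P.noise, ∃ q : ℕ → 𝒳, ch.IsRun q y ∧
    (∀ k, q (t₀ + k) = cc.coder k (fun i => x i)) ∧
    ∀ k, x (k + 1) = P.A.mulVec (x k) +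
      P.B.mulVec (cc.controller t₀ k (fun i => y (t₀ + i))) + v (t₀ + k)

/-- The control law does not depend on the starting time: in the closed loop, one and the same
function of the states and channel outputs since the start gives the control for all starting
times. This holds in particular if `cc.controller` does not depend on `t₀`. The starting time can
then serve the controller to decode the outputs, but cannot be signalled to the coder. -/
def IsUniform (cc : CoderController 𝒳 𝒴 n p) (P : LinearPlant n p)
    (ch : CausalChannel 𝒳 𝒴 𝒵) (l : ℝ) : Prop :=
  ∃ κ : (k : ℕ) → (Fin (k + 1) → (Fin n → ℝ)) → (Fin (k + 1) → 𝒴) → (Fin p → ℝ),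
    ∀ (t₀ : ℕ) (x : ℕ → Fin n → ℝ) (y : ℕ → 𝒴), cc.IsClosedLoopRun P ch l t₀ x y →
      ∀ k, cc.controller t₀ k (fun i => y (t₀ + i)) =
        κ k (fun i => x i) (fun i => y (t₀ + i))

/-- The state of the closed loop is uniformly bounded for initial states in the ball of
radius `l`: one bound holds at all times, for all starting times, all initial states and all noise
realizations. -/
def UniformlyBounded (cc : CoderController 𝒳 𝒴 n p) (P : LinearPlant n p)
    (ch : CausalChannel 𝒳 𝒴 𝒵) (l : ℝ) : Prop :=
  ∃ φ : ℝ, ∀ (t₀ : ℕ) (x : ℕ → Fin n → ℝ) (y : ℕ → 𝒴),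
    cc.IsClosedLoopRun P ch l t₀ x y → ∀ k, ‖x k‖ ≤ φ

end CoderController

/-! Both directions compare the number of messages of a code with the number of balls of fixed
radius needed for the image of a ball under `A ^ N`. Up to polynomial factors in `N` this number is
`2 ^ (N * linearEntropy A)` (`card_separated_le`, `le_card_cover`). The proof compares volumes in a
complex basis of generalized eigenvectors, where direction `i` is weighted by `max 1 ‖ev i‖ ^ N`.
Pairs of real points serve as complex points, so all counts are squared.

Necessity: the initial state is the message. Without plant noise, equal output blocks give equal
controls, so two runs differ at step `N` by `A ^ N` applied to the difference of their initial
states. If such images are more than twice the state bound apart, the output blocks must differ.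
Uniformity lets the encoder simulate the loop from the message and the fed back outputs without
knowing the starting time (`exists_zeroErrorCode_of_uniformlyBounded`). A maximal separated set is
also a cover, so the code has enough messages.

Sufficiency: if the capacity exceeds the entropy, some long code has at least as many messages as
there are balls of radius `1 / 2` needed to cover the image of the unit ball
(`exists_code_quantizer_gain`). In each block the coder sends the quantized estimation error: an
error of at most `R` becomes `R / 2` after quantization, and the plant noise adds at most another `R
/ 2`. The code needs output feedback, which the coder lacks. The controller knows the outputs but
not the message, so it adds to its control a signal for the map from messages to the next channel
input. There are finitely many such maps and `B` is nonzero, so the coder can read the signal from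
the next state despite the noise (`exists_signalling`). The signals are bounded and known on both
sides, hence they cancel in the estimation error; a linear feedback that halves the estimate over a
block keeps the estimate bounded. -/

/-! ### Bases of generalized eigenvectors. -/

open Module in
-- The primary decomposition suffices, no Jordan form is needed: nilpotent parts cost only
-- polynomial factors later. The dimension of a maximal generalized eigenspace is the algebraic
-- multiplicity, which gives the last clause.
theorem exists_basis_maxGenEigenspace {V : Type*} [AddCommGroup V] [Module ℂ V]
    [FiniteDimensional ℂ V] (f : Module.End ℂ V) :
    ∃ (ι : Type) (_ : Fintype ι) (b : Basis ι ℂ V) (ev : ι → ℂ),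
      (∀ i, b i ∈ f.maxGenEigenspace (ev i)) ∧
      (∀ μ, ∀ v ∈ f.maxGenEigenspace μ, ∀ i, ev i ≠ μ → b.repr v i = 0) ∧
      Finset.univ.val.map ev = (LinearMap.charpoly f).roots := by
  classical
  have hroot (μ : ℂ) : μ ∉ (LinearMap.charpoly f).roots → f.maxGenEigenspace μ = ⊥ := by
    intro h
    rw [← Submodule.finrank_eq_zero (R := ℂ), LinearMap.finrank_maxGenEigenspace_eq,
      ← Polynomial.count_roots, Multiset.count_eq_zero]
    exact h
  let s := (LinearMap.charpoly f).roots.toFinset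
  have hint : DirectSum.IsInternal fun μ : s => f.maxGenEigenspace (μ : ℂ) := by
    rw [DirectSum.isInternal_submodule_iff_iSupIndep_and_iSup_eq_top]
    refine ⟨f.independent_maxGenEigenspace.comp Subtype.val_injective, ?_⟩
    rw [eq_top_iff, ← Module.End.iSup_maxGenEigenspace_eq_top f]
    refine iSup_le fun μ => ?_
    by_cases h : μ ∈ s
    · exact le_iSup (fun μ : s => f.maxGenEigenspace (μ : ℂ)) ⟨μ, h⟩
    · rw [hroot μ (by simpa [s] using h)]
      exact bot_le
  let v (μ : s) := Module.finBasis ℂ (f.maxGenEigenspace (μ : ℂ))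
  let b := hint.collectedBasis v
  have hb : ∀ μ, ∀ w ∈ f.maxGenEigenspace μ,
      ∀ i : (Σ μ : s, Fin (finrank ℂ (f.maxGenEigenspace (μ : ℂ)))),
      ((i.1 : ℂ) ≠ μ → b.repr w i = 0) := by
    rintro μ w hw ⟨i, a⟩ hi
    by_cases h : μ ∈ s
    · refine hint.collectedBasis_repr_of_mem_ne v (i := ⟨μ, h⟩) (x := w) (a := a) ?_ hw
      rintro rfl
      exact hi rfl
    · rw [hroot μ (by simpa [s] using h), Submodule.mem_bot] at hw
      simp [hw]
  let e := (Fintype.equivFin (Σ μ : s, Fin (finrank ℂ (f.maxGenEigenspace (μ : ℂ)))))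
  refine ⟨Fin _, inferInstance, b.reindex e, fun i => ((e.symm i).1 : ℂ), fun i => ?_,
    fun μ w hw i hi => ?_, ?_⟩
  · rw [Module.Basis.reindex_apply]
    exact hint.collectedBasis_mem v (e.symm i)
  · simpa using hb μ w hw (e.symm i) hi
  · ext μ
    rw [Polynomial.count_roots, ← LinearMap.finrank_maxGenEigenspace_eq, Multiset.count_map]
    change Finset.card (Finset.univ.filter _) = _
    rw [← Fintype.card_subtype]
    have e1 : {i // μ = ((e.symm i).1 : ℂ)} ≃
        {i : (Σ μ : s, Fin (finrank ℂ (f.maxGenEigenspace (μ : ℂ)))) // (i.1 : ℂ) = μ} :=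
      e.symm.subtypeEquiv (fun a => eq_comm)
    rw [Fintype.card_congr e1]
    by_cases h : μ ∈ s
    · have e2 : {i : (Σ μ : s, Fin (finrank ℂ (f.maxGenEigenspace (μ : ℂ)))) // (i.1 : ℂ) = μ} ≃
          Fin (finrank ℂ (f.maxGenEigenspace μ)) :=
        (Equiv.subtypeEquivRight (fun i => by
          simpa using (Subtype.ext_iff (a1 := i.1) (a2 := ⟨μ, h⟩)).symm)).trans
          (Equiv.sigmaSubtype (β := fun ν : s => Fin (finrank ℂ (f.maxGenEigenspace (ν : ℂ))))
            ⟨μ, h⟩)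
      rw [Fintype.card_congr e2, Fintype.card_fin]
    · rw [hroot μ (by simpa [s] using h), finrank_bot, Fintype.card_eq_zero_iff]
      exact ⟨fun i => h (i.2 ▸ i.1.1.2)⟩

/-! ### Powers of an endomorphism on generalized eigenvectors. -/

section Growth

variable {V : Type*} [NormedAddCommGroup V] [NormedSpace ℂ V]

/-- The geometric sum identity for the commuting pair `f`, `μ`. On the right `f - μ` has been
applied to `v`, which lowers the nilpotency order by one; this drives the two inductions below. -/
theorem pow_apply_eq_smul_add_sum (f : Module.End ℂ V) (μ : ℂ) (N : ℕ) (v : V) :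
    (f ^ N) v = μ ^ N • v +
      ∑ j ∈ Finset.range N, μ ^ (N - 1 - j) • (f ^ j) ((f - algebraMap ℂ _ μ) v) := by
  have h := (Algebra.commute_algebraMap_right μ f).geom_sum₂_mul N
  have h' := congrArg (fun g : Module.End ℂ V => g v) h
  rw [← sub_eq_iff_eq_add']
  -- Made opaque so that `simp` does not distribute this difference over `v`.
  generalize f - algebraMap ℂ _ μ = g at h' ⊢
  simp only [← map_pow, Module.End.mul_apply, LinearMap.sum_apply, LinearMap.sub_apply,
    Module.algebraMap_end_apply, map_smul] at h'
  exact h'.symm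

/-- Each unit of nilpotency order adds a sum of `N` terms of the previous size, hence one factor `N
+ 1`. The rate `ρ` may exceed `‖μ‖`, which covers `μ = 0` and stable eigenvalues. -/
theorem exists_norm_pow_apply_le (f : Module.End ℂ V) {μ : ℂ} {ρ : ℝ} (hρ : 0 < ρ)
    (hμ : ‖μ‖ ≤ ρ) (m : ℕ) : ∀ v : V, ((f - algebraMap ℂ _ μ) ^ m) v = 0 →
      ∃ C : ℝ, 0 ≤ C ∧ ∀ N : ℕ, ‖(f ^ N) v‖ ≤ C * (N + 1) ^ m * ρ ^ N := by
  induction m with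
  | zero => intro v hv; exact ⟨0, le_rfl, fun N => by simp_all⟩
  | succ m ih =>
    intro v hv
    obtain ⟨C, hC, h⟩ := ih ((f - algebraMap ℂ _ μ) v) (by rwa [pow_succ] at hv)
    refine ⟨‖v‖ + C / ρ, by positivity, fun N => ?_⟩
    rw [pow_apply_eq_smul_add_sum f μ N v]
    have hterm : ∀ j ∈ Finset.range N,
        ‖μ ^ (N - 1 - j) • (f ^ j) ((f - algebraMap ℂ _ μ) v)‖ ≤
          C / ρ * (N + 1) ^ m * ρ ^ N := by
      intro j hj
      rw [Finset.mem_range] at hj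
      rw [norm_smul, norm_pow]
      calc ‖μ‖ ^ (N - 1 - j) * ‖(f ^ j) ((f - algebraMap ℂ _ μ) v)‖
          ≤ ρ ^ (N - 1 - j) * (C * (N + 1) ^ m * ρ ^ j) := by
            refine mul_le_mul (by gcongr) ((h j).trans ?_) (norm_nonneg _) (by positivity)
            gcongr
        _ = C / ρ * (N + 1) ^ m * ρ ^ N := by
            have : ρ ^ N = ρ ^ (N - 1 - j) * ρ ^ j * ρ := by
              rw [← pow_add, ← pow_succ]; congr 1; omega
            rw [this]; field_simp
    calc _ ≤ ‖μ ^ N • v‖ + ∑ j ∈ Finset.range N, C / ρ * (N + 1) ^ m * ρ ^ N :=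
          (norm_add_le _ _).trans (add_le_add le_rfl (norm_sum_le_of_le _ hterm))
      _ ≤ ρ ^ N * ‖v‖ + N * (C / ρ * (N + 1) ^ m * ρ ^ N) := by
          rw [norm_smul, norm_pow, Finset.sum_const, Finset.card_range, nsmul_eq_mul]
          gcongr
      _ ≤ ρ ^ N * ‖v‖ * (N + 1) ^ (m + 1) + (N + 1) * (C / ρ * (N + 1) ^ m * ρ ^ N) := by
          refine add_le_add (le_mul_of_one_le_right (by positivity) (one_le_pow₀ (by simp)))
            (mul_le_mul_of_nonneg_right (lt_add_one _).le (by positivity))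
      _ = _ := by ring

/-- The backward counterpart: for `μ ≠ 0` the vector `μ ^ N • v` has a preimage under `f ^ N` of
polynomial size. -/
theorem exists_pow_apply_eq_smul (f : Module.End ℂ V) {μ : ℂ} (hμ : μ ≠ 0) (m : ℕ) :
    ∀ v : V, ((f - algebraMap ℂ _ μ) ^ m) v = 0 →
      ∃ C : ℝ, 0 ≤ C ∧ ∀ N : ℕ, ∃ w : V, (f ^ N) w = μ ^ N • v ∧ ‖w‖ ≤ C * (N + 1) ^ m := by
  induction m with
  | zero => intro v hv; exact ⟨0, le_rfl, fun N => ⟨0, by simp_all⟩⟩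
  | succ m ih =>
    intro v hv
    obtain ⟨C, hC, h⟩ := ih ((f - algebraMap ℂ _ μ) v) (by rwa [pow_succ] at hv)
    choose w hw hwC using h
    -- `f ^ N` maps `μ⁻¹ • w (N - j)` to the term of index `j` by which `(f ^ N) v` exceeds `μ ^ N •
    -- v`.
    refine ⟨‖v‖ + ‖μ‖⁻¹ * C, by positivity, fun N =>
      ⟨v - ∑ j ∈ Finset.range N, μ⁻¹ • w (N - j), ?_, ?_⟩⟩
    · rw [map_sub, pow_apply_eq_smul_add_sum f μ N v, map_sum, add_sub_assoc,
        ← Finset.sum_sub_distrib, Finset.sum_eq_zero, add_zero]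
      intro j hj
      rw [Finset.mem_range] at hj
      have : f ^ N = f ^ j * f ^ (N - j) := by rw [← pow_add]; congr 1; omega
      rw [this, map_smul, Module.End.mul_apply, hw, map_smul, smul_smul, sub_eq_zero]
      congr 1
      have : μ ^ (N - j) = μ * μ ^ (N - 1 - j) := by rw [← pow_succ']; congr 1; omega
      rw [this, inv_mul_cancel_left₀ hμ]
    · have hterm : ∀ j ∈ Finset.range N, ‖μ⁻¹ • w (N - j)‖ ≤ ‖μ‖⁻¹ * (C * (N + 1) ^ m) := by
        intro j _
        rw [norm_smul, norm_inv]
        refine mul_le_mul_of_nonneg_left ((hwC _).trans ?_) (by positivity)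
        gcongr
        exact Nat.sub_le _ _
      calc _ ≤ ‖v‖ + ∑ j ∈ Finset.range N, ‖μ‖⁻¹ * (C * (N + 1) ^ m) :=
            (norm_sub_le _ _).trans (add_le_add le_rfl (norm_sum_le_of_le _ hterm))
        _ = ‖v‖ + N * (‖μ‖⁻¹ * (C * (N + 1) ^ m)) := by simp
        _ ≤ ‖v‖ * (N + 1) ^ (m + 1) + (N + 1) * (‖μ‖⁻¹ * (C * (N + 1) ^ m)) := by
            refine add_le_add (le_mul_of_one_le_right (by positivity) (one_le_pow₀ (by simp)))
              (mul_le_mul_of_nonneg_right (lt_add_one _).le (by positivity))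
        _ = _ := by ring

end Growth

/-! ### Volume comparison for polydiscs. -/

open MeasureTheory in
theorem volume_pi_closedBall_complex {ι : Type*} [Fintype ι] (a : ι → ℝ) (c : ι → ℂ) :
    volume (Set.univ.pi fun i => Metric.closedBall (c i) (a i)) =
      (∏ i, ENNReal.ofReal (a i) ^ 2) * (NNReal.pi : ENNReal) ^ Fintype.card ι := by
  rw [volume_pi_pi]
  simp [Complex.volume_closedBall, Finset.prod_mul_distrib]

open MeasureTheory in
theorem volume_pi_ball_complex {ι : Type*} [Fintype ι] (a : ι → ℝ) (c : ι → ℂ) :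
    volume (Set.univ.pi fun i => Metric.ball (c i) (a i)) =
      (∏ i, ENNReal.ofReal (a i) ^ 2) * (NNReal.pi : ENNReal) ^ Fintype.card ι := by
  rw [volume_pi_pi]
  simp [Complex.volume_ball, Finset.prod_mul_distrib]

-- The volume of the covered polydisc is at most the sum of the volumes of the covering ones; the
-- powers of `π` cancel.
open MeasureTheory in
theorem prod_sq_le_of_cover {ι κ : Type*} [Fintype ι] (K : Finset κ) (g : κ → ι → ℂ)
    {a : ι → ℝ} {δ : ℝ} (ha : ∀ i, 0 ≤ a i) (hδ : 0 ≤ δ)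
    (h : ∀ c : ι → ℂ, (∀ i, ‖c i‖ ≤ a i) → ∃ k ∈ K, ‖c - g k‖ ≤ δ) :
    ∏ i, a i ^ 2 ≤ K.card * ∏ _i : ι, δ ^ 2 := by
  have hsub : (Set.univ.pi fun i => Metric.closedBall (0 : ℂ) (a i)) ⊆
      ⋃ k ∈ K, Set.univ.pi fun i => Metric.closedBall (g k i) δ := by
    intro c hc
    obtain ⟨k, hk, hck⟩ := h c (fun i => by simpa using hc i trivial)
    refine Set.mem_biUnion hk fun i _ => ?_
    rw [mem_closedBall_iff_norm]
    exact (norm_le_pi_norm (c - g k) i).trans hck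
  have hvol := (measure_mono hsub).trans (measure_biUnion_finset_le (μ := volume) K _)
  simp only [volume_pi_closedBall_complex, Finset.sum_const, nsmul_eq_mul] at hvol
  rw [← mul_assoc] at hvol
  have hpi : (NNReal.pi : ENNReal) ^ Fintype.card ι ≠ 0 := by
    simp [NNReal.pi_ne_zero]
  have hpi' : (NNReal.pi : ENNReal) ^ Fintype.card ι ≠ ⊤ := by simp
  rw [ENNReal.mul_le_mul_iff_left hpi hpi'] at hvol
  have := ENNReal.toReal_mono (by simp [ENNReal.mul_eq_top]) hvol
  simpa [ENNReal.toReal_prod, ENNReal.toReal_ofReal, ha, hδ] using this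

-- The open polydiscs of radius `δ` around the points are disjoint and lie in the polydisc whose
-- radii are enlarged by `δ`.
open MeasureTheory in
theorem card_mul_prod_sq_le_of_separated {ι κ : Type*} [Fintype ι] (K : Finset κ)
    (g : κ → ι → ℂ) {a : ι → ℝ} {δ : ℝ} (ha : ∀ i, 0 ≤ a i) (hδ : 0 < δ)
    (h : ∀ k ∈ K, ∀ i, ‖g k i‖ ≤ a i)
    (hsep : ∀ k ∈ K, ∀ k' ∈ K, k ≠ k' → 2 * δ ≤ ‖g k - g k'‖) :
    K.card * ∏ _i : ι, δ ^ 2 ≤ ∏ i, (a i + δ) ^ 2 := by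
  have hsub : (⋃ k ∈ K, Set.univ.pi fun i => Metric.ball (g k i) δ) ⊆
      (Set.univ.pi fun i => Metric.closedBall (0 : ℂ) (a i + δ)) := by
    intro c hc i _
    obtain ⟨k, hk, hck⟩ := Set.mem_iUnion₂.1 hc
    have := hck i trivial
    rw [mem_ball_iff_norm] at this
    rw [mem_closedBall_zero_iff]
    have h3 := norm_le_norm_add_norm_sub' (c i) (g k i)
    have h4 := h k hk i
    linarith
  have hdisj : Set.PairwiseDisjoint (K : Set κ)
      fun k => Set.univ.pi fun i => Metric.ball (g k i) δ := by
    intro k hk k' hk' hne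
    refine Set.disjoint_left.2 fun c hc hc' => ?_
    have h1 := hsep k hk k' hk' hne
    have : ‖g k - g k'‖ < 2 * δ := by
      rw [pi_norm_lt_iff (by linarith)]
      intro i
      have h2 := hc i trivial
      have h3 := hc' i trivial
      rw [mem_ball_iff_norm] at h2 h3
      have := norm_sub_le (c i - g k' i) (c i - g k i)
      rw [sub_sub_sub_cancel_left] at this
      simp only [Pi.sub_apply]
      linarith
    linarith
  have hvol := measure_mono (μ := volume) hsub
  rw [measure_biUnion_finset hdisj
    (fun k _ => (MeasurableSet.univ_pi fun i => measurableSet_ball))] at hvol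
  simp only [volume_pi_closedBall_complex, volume_pi_ball_complex, Finset.sum_const,
    nsmul_eq_mul] at hvol
  rw [← mul_assoc] at hvol
  have hpi : (NNReal.pi : ENNReal) ^ Fintype.card ι ≠ 0 := by
    simp [NNReal.pi_ne_zero]
  have hpi' : (NNReal.pi : ENNReal) ^ Fintype.card ι ≠ ⊤ := by simp
  rw [ENNReal.mul_le_mul_iff_left hpi hpi'] at hvol
  have := ENNReal.toReal_mono (by simp [ENNReal.prod_ne_top]) hvol
  simpa [ENNReal.toReal_prod, ENNReal.toReal_ofReal, ha, hδ.le, add_nonneg] using this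

/-! ### Pairs of real vectors as complex vectors. -/

section complexPoint

variable {n : ℕ}

/-- The complex vector with given real and imaginary parts. -/
def complexPoint (x y : Fin n → ℝ) : Fin n → ℂ := fun i => ⟨x i, y i⟩

theorem complexPoint_sub (x y x' y' : Fin n → ℝ) :
    complexPoint x y - complexPoint x' y' = complexPoint (x - x') (y - y') := rfl

theorem norm_left_le_norm_complexPoint (x y : Fin n → ℝ) : ‖x‖ ≤ ‖complexPoint x y‖ :=
  (pi_norm_le_iff_of_nonneg (norm_nonneg _)).2 fun i =>
    (Complex.abs_re_le_norm (complexPoint x y i)).trans (norm_le_pi_norm (complexPoint x y) i)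

theorem norm_right_le_norm_complexPoint (x y : Fin n → ℝ) : ‖y‖ ≤ ‖complexPoint x y‖ :=
  (pi_norm_le_iff_of_nonneg (norm_nonneg _)).2 fun i =>
    (Complex.abs_im_le_norm (complexPoint x y i)).trans (norm_le_pi_norm (complexPoint x y) i)

theorem norm_complexPoint_le (x y : Fin n → ℝ) : ‖complexPoint x y‖ ≤ ‖x‖ + ‖y‖ :=
  (pi_norm_le_iff_of_nonneg (by positivity)).2 fun i =>
    (Complex.norm_le_abs_re_add_abs_im _).trans
      (add_le_add (norm_le_pi_norm x i) (norm_le_pi_norm y i))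

theorem exists_complexPoint_eq (z : Fin n → ℂ) :
    ∃ x y : Fin n → ℝ, complexPoint x y = z ∧ ‖x‖ ≤ ‖z‖ ∧ ‖y‖ ≤ ‖z‖ := by
  refine ⟨fun i => (z i).re, fun i => (z i).im, rfl, ?_, ?_⟩
  · exact norm_left_le_norm_complexPoint (fun i => (z i).re) (fun i => (z i).im)
  · exact norm_right_le_norm_complexPoint (fun i => (z i).re) (fun i => (z i).im)

theorem map_ofReal_mulVec_complexPoint {m : ℕ} (A : Matrix (Fin m) (Fin n) ℝ) (x y : Fin n → ℝ) :
    (A.map Complex.ofReal).mulVec (complexPoint x y) =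
      complexPoint (A.mulVec x) (A.mulVec y) := by
  ext i
  apply Complex.ext <;> simp [complexPoint, Matrix.mulVec, dotProduct]

theorem toLin'_map_ofReal_pow_complexPoint (A : Matrix (Fin n) (Fin n) ℝ) (N : ℕ)
    (x y : Fin n → ℝ) :
    ((Matrix.toLin' (A.map Complex.ofReal)) ^ N) (complexPoint x y) =
      complexPoint ((A ^ N).mulVec x) ((A ^ N).mulVec y) := by
  rw [← Matrix.toLin'_pow, Matrix.toLin'_apply, ← map_ofReal_mulVec_complexPoint]
  congr 1
  exact (map_pow Complex.ofRealHom.mapMatrix A N).symm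

end complexPoint

/-! ### Growth rates of the basis vectors and the entropy. -/

theorem prod_max_one_norm_eq {n : ℕ} (A : Matrix (Fin n) (Fin n) ℝ) {ι : Type} [Fintype ι]
    {ev : ι → ℂ}
    (h : Finset.univ.val.map ev =
      (LinearMap.charpoly (Matrix.toLin' (A.map Complex.ofReal))).roots) :
    ∏ i, max 1 ‖ev i‖ = (2 : ℝ) ^ linearEntropy A := by
  classical
  have hroots : complexEigenvalues A = Finset.univ.val.map ev := by
    rw [h, complexEigenvalues, Matrix.charpoly_toLin']
  have hent : linearEntropy A = ∑ i, Real.logb 2 (max 1 ‖ev i‖) := by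
    unfold linearEntropy
    rw [hroots, Multiset.filter_map, Multiset.map_map]
    change Finset.sum (Finset.univ.filter _) _ = _
    rw [Finset.sum_filter]
    refine Finset.sum_congr rfl fun i _ => ?_
    simp only [Function.comp]
    split_ifs with h1
    · rw [max_eq_right h1]
    · rw [max_eq_left (not_le.1 h1).le, Real.logb_one]
  have hpos : ∀ i, 0 < max 1 ‖ev i‖ := fun i => lt_max_of_lt_left one_pos
  rw [hent, ← Real.logb_prod _ _ (fun i _ => (hpos i).ne'),
    Real.rpow_logb two_pos (by norm_num) (Finset.prod_pos fun i _ => hpos i)]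

section

variable {V : Type*} [NormedAddCommGroup V] [NormedSpace ℂ V]

theorem exists_norm_pow_basis_le (f : Module.End ℂ V) {ι : Type} [Fintype ι] (b : ι → V)
    (ev : ι → ℂ) (hb : ∀ i, b i ∈ f.maxGenEigenspace (ev i)) :
    ∃ (C : ℝ) (m : ℕ), 0 < C ∧ ∀ (N : ℕ) (i : ι),
      ‖(f ^ N) (b i)‖ ≤ C * (N + 1) ^ m * max 1 ‖ev i‖ ^ N := by
  have h (i : ι) : ∃ (C : ℝ) (m : ℕ), 0 ≤ C ∧ ∀ N : ℕ,
      ‖(f ^ N) (b i)‖ ≤ C * (N + 1) ^ m * max 1 ‖ev i‖ ^ N := by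
    obtain ⟨m, hm⟩ := (f.mem_maxGenEigenspace _ _).1 (hb i)
    obtain ⟨C, hC, h⟩ := exists_norm_pow_apply_le f (lt_max_of_lt_left one_pos)
      (le_max_right 1 ‖ev i‖) m (b i) (by rwa [Algebra.algebraMap_eq_smul_one])
    exact ⟨C, m, hC, h⟩
  choose C m hC h using h
  refine ⟨1 + ∑ i, C i, ∑ i, m i, add_pos_of_pos_of_nonneg one_pos
    (Finset.sum_nonneg fun i _ => hC i), fun N i => (h i N).trans ?_⟩
  have h1 : C i ≤ 1 + ∑ i, C i :=
    (Finset.single_le_sum (f := C) (fun i _ => hC i) (Finset.mem_univ i)).trans (by linarith)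
  have h2 : m i ≤ ∑ i, m i := Finset.single_le_sum (fun i _ => Nat.zero_le _) (Finset.mem_univ i)
  have h3 : (1 : ℝ) ≤ N + 1 := by simp
  have h4 := hC i
  gcongr
  linarith

/-- The remainder `w'` serves the stable directions: their weight is `1`, and `b i` itself is the
remainder because `f ^ N` cannot reach it from small vectors. -/
theorem exists_pow_apply_add_eq_smul (f : Module.End ℂ V) {ι : Type} [Fintype ι] (b : ι → V)
    (ev : ι → ℂ) (hb : ∀ i, b i ∈ f.maxGenEigenspace (ev i)) :
    ∃ (C : ℝ) (m : ℕ), 0 < C ∧ ∀ (N : ℕ) (i : ι), ∃ w w' : V,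
      (f ^ N) w + w' = ((max 1 ‖ev i‖ : ℝ) : ℂ) ^ N • b i ∧ ‖w‖ ≤ C * (N + 1) ^ m ∧
      ‖w'‖ ≤ C := by
  have h (i : ι) : ∃ (C : ℝ) (m : ℕ), 0 ≤ C ∧ ∀ N : ℕ, ∃ w w' : V,
      (f ^ N) w + w' = ((max 1 ‖ev i‖ : ℝ) : ℂ) ^ N • b i ∧ ‖w‖ ≤ C * (N + 1) ^ m ∧
      ‖w'‖ ≤ C := by
    obtain ⟨m, hm⟩ := (f.mem_maxGenEigenspace _ _).1 (hb i)
    by_cases h1 : 1 ≤ ‖ev i‖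
    · have hne : ev i ≠ 0 := norm_pos_iff.1 (by linarith)
      obtain ⟨C, hC, h⟩ := exists_pow_apply_eq_smul f hne m (b i)
        (by rwa [Algebra.algebraMap_eq_smul_one])
      refine ⟨C, m, hC, fun N => ?_⟩
      obtain ⟨w, hw, hwC⟩ := h N
      -- A factor of modulus one turns `ev i ^ N` into `‖ev i‖ ^ N`.
      refine ⟨((‖ev i‖ : ℂ) / ev i) ^ N • w, 0, ?_, ?_, by simpa⟩
      · rw [map_smul, hw, smul_smul, add_zero, max_eq_right h1, ← mul_pow, div_mul_cancel₀ _ hne]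
      · rw [norm_smul, norm_pow, norm_div, Complex.norm_real, norm_norm, div_self (by simpa),
          one_pow, one_mul]
        exact hwC
    · refine ⟨‖b i‖, 0, norm_nonneg _, fun N => ⟨0, b i, ?_, by simp, le_rfl⟩⟩
      rw [max_eq_left (not_le.1 h1).le]
      simp
  choose C m hC h using h
  have hsum : 0 < 1 + ∑ i, C i := add_pos_of_pos_of_nonneg one_pos
    (Finset.sum_nonneg fun i _ => hC i)
  refine ⟨1 + ∑ i, C i, ∑ i, m i, hsum, fun N i => ?_⟩
  obtain ⟨w, w', h, hw, hw'⟩ := h i N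
  have h1 : C i ≤ 1 + ∑ i, C i :=
    (Finset.single_le_sum (f := C) (fun i _ => hC i) (Finset.mem_univ i)).trans (by linarith)
  have h2 : m i ≤ ∑ i, m i := Finset.single_le_sum (fun i _ => Nat.zero_le _) (Finset.mem_univ i)
  have h3 : (1 : ℝ) ≤ N + 1 := by simp
  refine ⟨w, w', h, hw.trans ?_, hw'.trans h1⟩
  gcongr

end

/-! ### Packing and covering numbers of the image of a ball. -/

/-- In eigenvector coordinates the complexified image lies in a polydisc with radii of order `(N +
1) ^ m * ρ i ^ N`. Packing it with the pairs from `T ×ˢ T` bounds the square of `T.card`. -/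
theorem card_separated_le {n : ℕ} (A : Matrix (Fin n) (Fin n) ℝ) {l r : ℝ} (hl : 0 ≤ l)
    (hr : 0 < r) :
    ∃ (C : ℝ) (m : ℕ), 0 < C ∧ ∀ (N : ℕ) (T : Finset (Fin n → ℝ)),
      (∀ t ∈ T, ∃ x, ‖x‖ ≤ l ∧ (A ^ N).mulVec x = t) →
      (∀ t ∈ T, ∀ t' ∈ T, t ≠ t' → r < ‖t - t'‖) →
      (T.card : ℝ) ≤ C * (N + 1) ^ m * ((2 : ℝ) ^ linearEntropy A) ^ N := by
  classical
  set f : Module.End ℂ (Fin n → ℂ) := Matrix.toLin' (A.map Complex.ofReal) with hf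
  obtain ⟨ι, _, b, ev, hb, hb', hev⟩ := exists_basis_maxGenEigenspace f
  obtain ⟨C, m, hC, hgrow⟩ := exists_norm_pow_basis_le f b ev hb
  let φ : (Fin n → ℂ) ≃L[ℂ] (ι → ℂ) := b.equivFun.toContinuousLinearEquiv
  have hφ (v : Fin n → ℂ) (i : ι) : φ v i = b.repr v i := rfl
  let ρ : ι → ℝ := fun i => max 1 ‖ev i‖
  have hρ (i : ι) : 1 ≤ ρ i := le_max_left _ _
  obtain ⟨L, hL, hLφ⟩ : ∃ L > 0, ∀ v, ‖φ v‖ ≤ L * ‖v‖ :=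
    ⟨‖(φ : (Fin n → ℂ) →L[ℂ] (ι → ℂ))‖ + 1, by positivity, fun v =>
      ((φ : (Fin n → ℂ) →L[ℂ] (ι → ℂ)).le_opNorm v).trans (by gcongr; linarith)⟩
  obtain ⟨L', hL', hLφ'⟩ : ∃ L > 0, ∀ v, ‖v‖ ≤ L * ‖φ v‖ :=
    ⟨‖(φ.symm : (ι → ℂ) →L[ℂ] (Fin n → ℂ))‖ + 1, by positivity, fun v =>
      (by simpa using (φ.symm : (ι → ℂ) →L[ℂ] (Fin n → ℂ)).le_opNorm (φ v) :
        ‖v‖ ≤ ‖(φ.symm : (ι → ℂ) →L[ℂ] (Fin n → ℂ))‖ * ‖φ v‖).trans (by gcongr; linarith)⟩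
  have hcoord (N : ℕ) (z : Fin n → ℂ) (hz : ‖z‖ ≤ 2 * l) (i : ι) :
      ‖φ ((f ^ N) z) i‖ ≤ Fintype.card ι * (L * (2 * l)) * (L * C) * (N + 1) ^ m * ρ i ^ N := by
    have h1 : φ ((f ^ N) z) i = ∑ j, φ z j * φ ((f ^ N) (b j)) i := by
      have h2 : (f ^ N) z = ∑ j, b.repr z j • (f ^ N) (b j) := by
        conv_lhs => rw [← b.sum_repr z, map_sum]
        simp only [map_smul]
      rw [h2]
      simp only [map_sum, map_smul, Finset.sum_apply, Pi.smul_apply, smul_eq_mul]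
      rfl
    rw [h1]
    refine (norm_sum_le _ _).trans ?_
    have h2 (j : ι) : ‖φ z j * φ ((f ^ N) (b j)) i‖ ≤
        (L * (2 * l)) * ((L * C) * (N + 1) ^ m * ρ i ^ N) := by
      rw [norm_mul]
      have h3 : ‖φ z j‖ ≤ L * (2 * l) := (norm_le_pi_norm (φ z) j).trans
        ((hLφ z).trans (by gcongr))
      refine mul_le_mul h3 ?_ (norm_nonneg _) (by positivity)
      -- Powers of `f` do not mix different eigenvalues, so only basis vectors growing at the rate
      -- of direction `i` contribute to coordinate `i`.
      by_cases hij : ev i = ev j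
      · have h4 := hgrow N j
        rw [← hij] at h4
        calc _ ≤ ‖φ ((f ^ N) (b j))‖ := norm_le_pi_norm _ i
          _ ≤ L * ‖(f ^ N) (b j)‖ := hLφ _
          _ ≤ L * (C * (N + 1) ^ m * ρ i ^ N) := by gcongr
          _ = _ := by ring
      · have hmem : (f ^ N) (b j) ∈ f.maxGenEigenspace (ev j) :=
          f.mapsTo_maxGenEigenspace_of_comm ((Commute.refl f).pow_right N) (ev j) (hb j)
        rw [hφ, hb' _ _ hmem i hij, norm_zero]
        have := hρ i
        positivity
    refine (Finset.sum_le_sum fun j _ => h2 j).trans (le_of_eq ?_)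
    simp
    ring
  set K : ℝ := Fintype.card ι * (L * (2 * l)) * (L * C) with hK
  have hK0 : 0 ≤ K := by positivity
  -- Separation `r` of vectors becomes separation `2 * δ` of coordinates.
  set δ : ℝ := r / (2 * L') with hδ
  have hδ0 : 0 < δ := by positivity
  refine ⟨((K + δ) / δ) ^ Fintype.card ι, m * Fintype.card ι, by positivity, fun N T hT hsep => ?_⟩
  have hcount := card_mul_prod_sq_le_of_separated (T ×ˢ T)
    (fun t => φ (complexPoint t.1 t.2)) (a := fun i => K * (N + 1) ^ m * ρ i ^ N) (δ := δ)
    (fun i => by have := hρ i; positivity) hδ0 ?_ ?_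
  · have hle : ∏ i, (K * (N + 1) ^ m * ρ i ^ N + δ) ^ 2 ≤
        (∏ i, ((K + δ) * (N + 1) ^ m * ρ i ^ N)) ^ 2 := by
      rw [← Finset.prod_pow]
      refine Finset.prod_le_prod (fun i _ => by positivity) fun i _ => ?_
      have h1 : (1 : ℝ) ≤ (N + 1) ^ m * ρ i ^ N :=
        one_le_mul_of_one_le_of_one_le (one_le_pow₀ (by simp)) (one_le_pow₀ (hρ i))
      have h2 : K * (N + 1) ^ m * ρ i ^ N + δ ≤ (K + δ) * (N + 1) ^ m * ρ i ^ N := by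
        nlinarith
      have := hρ i
      gcongr
    have h3 : ((T.card : ℝ) * δ ^ Fintype.card ι) ^ 2 ≤
        (∏ i, ((K + δ) * (N + 1) ^ m * ρ i ^ N)) ^ 2 := by
      refine le_trans (le_of_eq ?_) (hcount.trans hle)
      simp [Finset.card_product, ← pow_mul]
      ring
    have hρ0 : ∀ i, 0 ≤ ρ i := fun i => zero_le_one.trans (hρ i)
    have h4 := (pow_le_pow_iff_left₀ (by positivity)
      (Finset.prod_nonneg fun i _ => by have := hρ0 i; positivity) two_ne_zero).1 h3
    rw [← le_div_iff₀ (by positivity)] at h4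
    refine h4.trans (le_of_eq ?_)
    have hprod : ∏ i, ρ i = _ := prod_max_one_norm_eq A hev
    rw [← hprod, Finset.prod_mul_distrib, Finset.prod_pow, Finset.prod_const,
      Finset.card_univ, mul_pow, div_pow (K + δ), ← pow_mul]
    clear_value δ K ρ
    field_simp
  · rintro ⟨t, t'⟩ ht i
    rw [Finset.mem_product] at ht
    obtain ⟨x, hx, rfl⟩ := hT t ht.1
    obtain ⟨x', hx', rfl⟩ := hT t' ht.2
    rw [← toLin'_map_ofReal_pow_complexPoint]
    exact hcoord N _ ((norm_complexPoint_le x x').trans (by linarith)) i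
  · rintro ⟨t, t'⟩ ht ⟨u, u'⟩ hu hne
    rw [Finset.mem_product] at ht hu
    rw [← map_sub, complexPoint_sub]
    have h1 : r < ‖complexPoint (t - u) (t' - u')‖ := by
      by_cases htu : t = u
      · have : t' ≠ u' := fun h => hne (by rw [htu, h])
        exact (hsep _ ht.2 _ hu.2 this).trans_le (norm_right_le_norm_complexPoint _ _)
      · exact (hsep _ ht.1 _ hu.1 htu).trans_le (norm_left_le_norm_complexPoint _ _)
    have h2 := hLφ' (complexPoint (t - u) (t' - u'))
    have h3 : 2 * δ = r / L' := by rw [hδ]; field_simp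
    rw [h3, div_le_iff₀ hL', mul_comm]
    exact (h1.trans_le h2).le

/-- Each point of a polydisc with radii of order `ρ i ^ N / (N + 1) ^ m` represents a vector `(f ^
N) w + w'` with `w` in the initial ball and `w'` bounded. A cover of the image therefore covers this
polydisc, `w'` only enlarging the radius. -/
theorem le_card_cover {n : ℕ} (A : Matrix (Fin n) (Fin n) ℝ) {l r : ℝ} (hl : 0 < l)
    (hr : 0 ≤ r) :
    ∃ (C : ℝ) (m : ℕ), 0 < C ∧ ∀ (N : ℕ) (T : Finset (Fin n → ℝ)),
      (∀ x, ‖x‖ ≤ l → ∃ t ∈ T, ‖(A ^ N).mulVec x - t‖ ≤ r) →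
      ((2 : ℝ) ^ linearEntropy A) ^ N ≤ C * (N + 1) ^ m * T.card := by
  classical
  set f : Module.End ℂ (Fin n → ℂ) := Matrix.toLin' (A.map Complex.ofReal) with hf
  obtain ⟨ι, _, b, ev, hb, hb', hev⟩ := exists_basis_maxGenEigenspace f
  obtain ⟨C, m, hC, hgrow⟩ := exists_pow_apply_add_eq_smul f b ev hb
  let φ : (Fin n → ℂ) ≃L[ℂ] (ι → ℂ) := b.equivFun.toContinuousLinearEquiv
  have hφ' (c : ι → ℂ) : φ.symm c = ∑ i, c i • b i := b.equivFun_symm_apply c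
  let ρ : ι → ℝ := fun i => max 1 ‖ev i‖
  have hρ (i : ι) : 1 ≤ ρ i := le_max_left _ _
  obtain ⟨L, hL, hLφ⟩ : ∃ L > 0, ∀ v, ‖φ v‖ ≤ L * ‖v‖ :=
    ⟨‖(φ : (Fin n → ℂ) →L[ℂ] (ι → ℂ))‖ + 1, by positivity, fun v =>
      ((φ : (Fin n → ℂ) →L[ℂ] (ι → ℂ)).le_opNorm v).trans (by gcongr; linarith)⟩
  set d : ℝ := (Fintype.card ι : ℝ) with hd
  -- Small enough for the `d` contributions to `w` to add up to at most `l`.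
  set δ : ℝ := l / ((d + 1) * C) with hδ
  have hδ0 : 0 < δ := by positivity
  -- An error `r` from each of the real and imaginary parts, plus the remainder; the `1` ensures
  -- positivity.
  set R : ℝ := L * (2 * r + d * δ * C + 1) with hR
  have hR0 : 0 < R := by positivity
  have hsplit (N : ℕ) (c : ι → ℂ) (hc : ∀ i, ‖c i‖ ≤ δ / (N + 1) ^ m * ρ i ^ N) :
      ∃ w w' : Fin n → ℂ, φ.symm c = (f ^ N) w + w' ∧ ‖w‖ ≤ l ∧ ‖w'‖ ≤ d * δ * C := by
    choose w w' hw hwC hwC' using hgrow N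
    have hρN (i : ι) : ((ρ i : ℂ)) ^ N ≠ 0 := by
      have := hρ i
      exact pow_ne_zero _ (Complex.ofReal_ne_zero.2 (by linarith))
    have hco (i : ι) : ‖c i / (ρ i : ℂ) ^ N‖ ≤ δ / (N + 1) ^ m := by
      have := hρ i
      rw [norm_div, norm_pow, Complex.norm_real, Real.norm_of_nonneg (by linarith),
        div_le_iff₀ (by positivity)]
      exact hc i
    refine ⟨∑ i, (c i / (ρ i : ℂ) ^ N) • w i, ∑ i, (c i / (ρ i : ℂ) ^ N) • w' i, ?_, ?_, ?_⟩
    · rw [hφ', map_sum, ← Finset.sum_add_distrib]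
      refine Finset.sum_congr rfl fun i _ => ?_
      rw [map_smul, ← smul_add, hw i, smul_smul]
      congr 1
      exact (div_mul_cancel₀ _ (hρN i)).symm
    · have : ∀ i ∈ Finset.univ, ‖(c i / (ρ i : ℂ) ^ N) • w i‖ ≤ δ * C := by
        intro i _
        rw [norm_smul]
        calc _ ≤ δ / (N + 1) ^ m * (C * (N + 1) ^ m) :=
              mul_le_mul (hco i) (hwC i) (norm_nonneg _) (by positivity)
          _ = δ * C := by field_simp
      refine (norm_sum_le_of_le _ this).trans ?_
      rw [Finset.sum_const, nsmul_eq_mul, Finset.card_univ, hδ]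
      have : d * (l / ((d + 1) * C) * C) = l * (d / (d + 1)) := by field_simp
      rw [this]
      exact mul_le_of_le_one_right hl.le ((div_le_one (by positivity)).2 (by linarith))
    · have : ∀ i ∈ Finset.univ, ‖(c i / (ρ i : ℂ) ^ N) • w' i‖ ≤ δ * C := by
        intro i _
        rw [norm_smul]
        refine mul_le_mul ((hco i).trans ?_) (hwC' i) (norm_nonneg _) hδ0.le
        exact div_le_self hδ0.le (one_le_pow₀ (by simp))
      refine (norm_sum_le_of_le _ this).trans (le_of_eq ?_)
      rw [Finset.sum_const, nsmul_eq_mul, Finset.card_univ, mul_assoc]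
  refine ⟨(R / δ) ^ Fintype.card ι, m * Fintype.card ι, by positivity, fun N T hT => ?_⟩
  have hρ0 : ∀ i, 0 ≤ ρ i := fun i => zero_le_one.trans (hρ i)
  have hcount := prod_sq_le_of_cover (T ×ˢ T) (fun t => φ (complexPoint t.1 t.2))
    (a := fun i => δ / (N + 1) ^ m * ρ i ^ N) (δ := R)
    (fun i => by have := hρ0 i; positivity) hR0.le ?_
  · have h3 : (∏ i, (δ / (N + 1) ^ m * ρ i ^ N)) ^ 2 ≤ ((T.card : ℝ) * R ^ Fintype.card ι) ^ 2 := by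
      refine le_trans (le_of_eq ?_) (hcount.trans (le_of_eq ?_))
      · rw [← Finset.prod_pow]
      · simp [Finset.card_product, ← pow_mul]
        ring
    have h4 := (pow_le_pow_iff_left₀ (Finset.prod_nonneg fun i _ => by have := hρ0 i; positivity)
      (by positivity) two_ne_zero).1 h3
    rw [Finset.prod_mul_distrib, Finset.prod_pow, Finset.prod_const, Finset.card_univ,
      prod_max_one_norm_eq A hev, ← le_div_iff₀' (by positivity)] at h4
    refine h4.trans (le_of_eq ?_)
    clear_value δ R
    rw [div_pow δ, div_pow R, ← pow_mul]
    field_simp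
  · intro c hc
    obtain ⟨w, w', h, hw, hw'⟩ := hsplit N c hc
    obtain ⟨x, y, rfl, hx, hy⟩ := exists_complexPoint_eq w
    obtain ⟨t, ht, hxt⟩ := hT x (hx.trans hw)
    obtain ⟨t', ht', hyt⟩ := hT y (hy.trans hw)
    refine ⟨(t, t'), Finset.mk_mem_product ht ht', ?_⟩
    rw [← φ.apply_symm_apply c, ← map_sub, h, toLin'_map_ofReal_pow_complexPoint]
    refine (hLφ _).trans (mul_le_mul_of_nonneg_left ?_ hL.le)
    rw [add_sub_right_comm, complexPoint_sub]
    have := norm_complexPoint_le ((A ^ N).mulVec x - t) ((A ^ N).mulVec y - t')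
    have := norm_add_le (complexPoint ((A ^ N).mulVec x - t) ((A ^ N).mulVec y - t')) w'
    linarith

/-- A separated set of maximal size is a cover; the maximum exists by `card_separated_le`. -/
theorem exists_separated_cover {n : ℕ} (A : Matrix (Fin n) (Fin n) ℝ) {l r : ℝ} (hl : 0 ≤ l)
    (hr : 0 < r) (N : ℕ) :
    ∃ T : Finset (Fin n → ℝ), (∀ t ∈ T, ∃ x, ‖x‖ ≤ l ∧ (A ^ N).mulVec x = t) ∧
      (∀ t ∈ T, ∀ t' ∈ T, t ≠ t' → r < ‖t - t'‖) ∧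
      ∀ x, ‖x‖ ≤ l → ∃ t ∈ T, ‖(A ^ N).mulVec x - t‖ ≤ r := by
  classical
  obtain ⟨C, m, -, hcard⟩ := card_separated_le A hl hr
  let S : Set ℕ := {k | ∃ T : Finset (Fin n → ℝ),
    (∀ t ∈ T, ∃ x, ‖x‖ ≤ l ∧ (A ^ N).mulVec x = t) ∧
      (∀ t ∈ T, ∀ t' ∈ T, t ≠ t' → r < ‖t - t'‖) ∧ T.card = k}
  have hne : S.Nonempty := ⟨0, ∅, by simp⟩
  have hbdd : BddAbove S := by
    refine ⟨⌊C * (N + 1) ^ m * ((2 : ℝ) ^ linearEntropy A) ^ N⌋₊, ?_⟩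
    rintro _ ⟨T, hT, hsep, rfl⟩
    exact Nat.le_floor (hcard N T hT hsep)
  obtain ⟨T, hT, hsep, hmax⟩ := Nat.sSup_mem hne hbdd
  refine ⟨T, hT, hsep, fun x hx => ?_⟩
  by_contra! hcon
  have hx' : (A ^ N).mulVec x ∉ T := fun h => by
    have := hcon _ h
    rw [sub_self, norm_zero] at this
    linarith
  have : (insert ((A ^ N).mulVec x) T).card ∈ S := by
    refine ⟨_, ?_, ?_, rfl⟩
    · simp only [Finset.forall_mem_insert]
      exact ⟨⟨x, hx, rfl⟩, hT⟩
    · simp only [Finset.forall_mem_insert]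
      refine ⟨⟨fun h => (h rfl).elim, fun t ht _ => hcon t ht⟩, fun t ht =>
        ⟨fun _ => by rw [norm_sub_rev]; exact hcon t ht, hsep t ht⟩⟩
  have := le_csSup hbdd this
  rw [Finset.card_insert_of_notMem hx', hmax] at this
  omega

open Filter in
theorem eventually_const_mul_pow_lt_pow (C : ℝ) (m : ℕ) {a : ℝ} (ha : 1 < a) :
    ∀ᶠ N : ℕ in atTop, C * (N + 1) ^ m < a ^ N := by
  have h := ((tendsto_pow_const_div_const_pow_of_one_lt m ha).comp
    (tendsto_add_atTop_nat 1)).const_mul (C * a)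
  rw [mul_zero] at h
  filter_upwards [h.eventually_lt_const one_pos] with N hN
  have ha0 : 0 < a := by linarith
  simp only [Function.comp, Nat.cast_add, Nat.cast_one, pow_succ] at hN
  rw [← mul_div_assoc, div_lt_one (by positivity)] at hN
  nlinarith

/-! ### Necessity: a code from a bounded closed loop. -/

/-- The sequence in which each term is computed from all the previous ones. -/
theorem exists_seq_of_history_step {α : Type*} (a : α) (step : (k : ℕ) → (Fin (k + 1) → α) → α) :
    ∃ x : ℕ → α, x 0 = a ∧ ∀ k, x (k + 1) = step k (fun i => x i) := by
  let H : (k : ℕ) → Fin (k + 1) → α := fun k => Nat.rec (fun _ => a)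
    (fun k h => Fin.snoc (α := fun _ => α) h (step k h)) k
  have hH (k : ℕ) : H (k + 1) = Fin.snoc (α := fun _ => α) (H k) (step k (H k)) := rfl
  have hval (k j : ℕ) (hj : j < k + 1) : H k ⟨j, hj⟩ = H j (Fin.last j) := by
    induction k with
    | zero =>
      obtain rfl : j = 0 := by omega
      rfl
    | succ k ih =>
      by_cases h : j < k + 1
      · rw [← ih h, hH]
        exact Fin.snoc_castSucc (α := fun _ => α) _ _ ⟨j, h⟩
      · obtain rfl : j = k + 1 := by omega
        rfl
  refine ⟨fun k => H k (Fin.last k), rfl, fun k => ?_⟩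
  have : (fun i : Fin (k + 1) => H i (Fin.last i)) = H k := by
    ext i
    exact (hval k i i.2).symm
  simp only [this, hH]
  exact Fin.snoc_last (α := fun _ => α) _ _

namespace CausalChannel

variable {𝒳 𝒴 𝒵 : Type*}

theorem nonempty_output [Nonempty 𝒳] (ch : CausalChannel 𝒳 𝒴 𝒵) : Nonempty 𝒴 :=
  ⟨ch.out 0 (fun _ => Classical.arbitrary 𝒳) (fun _ => (ch.noise_nonempty 0).some)⟩

end CausalChannel

namespace CoderController

variable {𝒳 𝒴 𝒵 : Type*} {n p : ℕ}

/-- Without plant noise, the closed loop runs for every initial state in the ball, every channel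
noise and all earlier channel inputs. -/
theorem exists_isClosedLoopRun (cc : CoderController 𝒳 𝒴 n p) (P : LinearPlant n p)
    (hzero : (fun _ => 0) ∈ P.noise) (ch : CausalChannel 𝒳 𝒴 𝒵) {l : ℝ} (t₀ : ℕ)
    {x₀ : Fin n → ℝ} (hx₀ : ‖x₀‖ ≤ l) (q₀ : ℕ → 𝒳) {z : ℕ → 𝒵} (hz : ∀ t, z t ∈ ch.noise t) :
    ∃ (x : ℕ → Fin n → ℝ) (y : ℕ → 𝒴) (q : ℕ → 𝒳), x 0 = x₀ ∧
      cc.IsClosedLoopRun P ch l t₀ x y ∧ (∀ t < t₀, q t = q₀ t) ∧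
      (∀ k, q (t₀ + k) = cc.coder k (fun i => x i)) ∧
      (∀ t, y t = ch.out t (fun i => q i) (fun i => z i)) ∧
      ∀ k, x (k + 1) = P.A.mulVec (x k) +
        P.B.mulVec (cc.controller t₀ k (fun i => y (t₀ + i))) := by
  let Q (x : ℕ → Fin n → ℝ) (t : ℕ) : 𝒳 :=
    if t < t₀ then q₀ t else cc.coder (t - t₀) (fun i => x i)
  let Y (x : ℕ → Fin n → ℝ) (t : ℕ) : 𝒴 := ch.out t (fun i => Q x i) (fun i => z i)
  -- Causality: inputs and outputs up to time `t₀ + k` depend only on the states up to step `k`, so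
  -- the recursion may extend a history arbitrarily.
  have hQ (x x' : ℕ → Fin n → ℝ) (k t : ℕ) (ht : t ≤ t₀ + k) (h : ∀ j ≤ k, x j = x' j) :
      Q x t = Q x' t := by
    simp only [Q]
    split_ifs
    · rfl
    · congr 1
      ext1 i
      exact h i (by omega)
  have hY (x x' : ℕ → Fin n → ℝ) (k t : ℕ) (ht : t ≤ t₀ + k) (h : ∀ j ≤ k, x j = x' j) :
      Y x t = Y x' t := by
    simp only [Y]
    congr 1
    ext1 i
    exact hQ x x' k i (by omega) h
  obtain ⟨x, hx0, hx⟩ := exists_seq_of_history_step x₀ (fun k h =>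
    P.A.mulVec (h (Fin.last k)) + P.B.mulVec (cc.controller t₀ k (fun i =>
      Y (fun j => h ⟨min j k, by omega⟩) (t₀ + i))))
  have hrec (k : ℕ) : x (k + 1) = P.A.mulVec (x k) +
      P.B.mulVec (cc.controller t₀ k (fun i => Y x (t₀ + i))) := by
    rw [hx]
    congr 3
    ext1 i
    exact hY (fun j => x (min j k)) x k (t₀ + i) (by omega) fun j hj => by rw [min_eq_left hj]
  have hq (k : ℕ) : Q x (t₀ + k) = cc.coder k (fun i => x i) := by
    have h1 : ¬ t₀ + k < t₀ := by omega
    simp only [Q, if_neg h1]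
    have h2 : ∀ j, j = k → cc.coder j (fun i => x i) = cc.coder k (fun i => x i) := by
      rintro _ rfl; rfl
    exact h2 _ (by omega)
  refine ⟨x, Y x, Q x, hx0, ⟨hx0 ▸ hx₀, _, hzero, Q x, ⟨z, hz, fun t => rfl⟩, hq, fun k => ?_⟩,
    fun t ht => if_pos ht, hq, fun t => rfl, hrec⟩
  rw [add_zero]
  exact hrec k

/-- A coder-controller that keeps the state bounded transmits, by means of the initial state, as
many messages as there are separated points in the image of the initial ball. -/
theorem exists_zeroErrorCode_of_uniformlyBounded [Nonempty 𝒳] {cc : CoderController 𝒳 𝒴 n p}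
    {P : LinearPlant n p} (hzero : (fun _ => 0) ∈ P.noise) {ch : CausalChannel 𝒳 𝒴 𝒵} {l φ : ℝ}
    (hunif : cc.IsUniform P ch l)
    (hφ : ∀ (t₀ : ℕ) (x : ℕ → Fin n → ℝ) (y : ℕ → 𝒴),
      cc.IsClosedLoopRun P ch l t₀ x y → ∀ k, ‖x k‖ ≤ φ)
    {M : ℕ} (N : ℕ) (x₀ : Fin M → Fin n → ℝ) (hx₀ : ∀ m, ‖x₀ m‖ ≤ l)
    (hsep : ∀ m m', m ≠ m' →
      2 * φ < ‖(P.A ^ N).mulVec (x₀ m) - (P.A ^ N).mulVec (x₀ m')‖) :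
    ∃ f : CausalChannel.FeedbackEncoder 𝒳 𝒴 M N, ch.IsUniformZeroError f := by
  have : Nonempty 𝒴 := ch.nonempty_output
  obtain ⟨κ, hκ⟩ := hunif
  -- `κ` instead of `cc.controller`: the encoder of a uniform code does not know `t₀`.
  have hsim (m : Fin M) (y : ℕ → 𝒴) : ∃ x : ℕ → Fin n → ℝ, x 0 = x₀ m ∧
      ∀ k, x (k + 1) = P.A.mulVec (x k) + P.B.mulVec (κ k (fun i => x i) (fun i => y i)) :=
    exists_seq_of_history_step (x₀ m) fun k h =>
      P.A.mulVec (h (Fin.last k)) + P.B.mulVec (κ k h (fun i => y i))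
  choose sim hsim0 hsim using hsim
  -- The padding value is immaterial: the simulated states up to step `i` use only the outputs
  -- before `i`.
  let ext (i : ℕ) (w : Fin i → 𝒴) (j : ℕ) : 𝒴 :=
    if h : j < i then w ⟨j, h⟩ else Classical.arbitrary 𝒴
  let f : CausalChannel.FeedbackEncoder 𝒳 𝒴 M N := fun i m w =>
    cc.coder i (fun j => sim m (ext i w) j)
  have key (t₀ : ℕ) (m : Fin M) (w : Fin N → 𝒴) (hw : w ∈ ch.outputRange f t₀ m) :
      ∃ (x : ℕ → Fin n → ℝ) (y : ℕ → 𝒴), x 0 = x₀ m ∧ cc.IsClosedLoopRun P ch l t₀ x y ∧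
        (∀ i : Fin N, y (t₀ + i) = w i) ∧
        ∀ k, x (k + 1) = P.A.mulVec (x k) +
          P.B.mulVec (cc.controller t₀ k (fun i => y (t₀ + i))) := by
    obtain ⟨q₀, y₀, ⟨z, hz, hy₀⟩, hq₀, hwy⟩ := hw
    obtain ⟨x, y, q, hx0, hrun, hqq, hq, hy, hx⟩ :=
      cc.exists_isClosedLoopRun P hzero ch t₀ (hx₀ m) q₀ hz
    -- The closed loop with the same channel noise and earlier inputs reproduces the transmission of
    -- the code; simulated states, inputs and outputs are matched by a joint induction.
    have hstep (i : ℕ) (hi : i < N) : q (t₀ + i) = q₀ (t₀ + i) ∧ y (t₀ + i) = y₀ (t₀ + i) := by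
      induction i using Nat.strong_induction_on with
      | _ i ih =>
        have hxs : ∀ j ≤ i, x j = sim m (ext i (fun j => y₀ (t₀ + j))) j := by
          intro j
          induction j using Nat.strong_induction_on with
          | _ j ihj =>
            intro hj
            cases j with
            | zero => rw [hx0, hsim0]
            | succ j =>
              rw [hx, hsim, hκ t₀ x y hrun j, ihj j (by omega) (by omega)]
              congr 3
              · ext1 a
                exact ihj a (by omega) (by omega)
              · ext1 a
                have ha : (a : ℕ) < i := by omega
                simp only [ext, dif_pos ha]
                exact (ih a ha (by omega)).2
        have hqi : q (t₀ + i) = q₀ (t₀ + i) := by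
          rw [hq, hq₀ ⟨i, hi⟩]
          simp only [f]
          congr 1
          ext1 a
          exact hxs a (by omega)
        refine ⟨hqi, ?_⟩
        rw [hy, hy₀]
        congr 1
        ext1 a
        by_cases ha : (a : ℕ) < t₀
        · exact hqq a ha
        · obtain ⟨c, hc⟩ := Nat.exists_eq_add_of_le (not_lt.1 ha)
          rw [hc]
          rcases (show c ≤ i by omega).lt_or_eq with h | rfl
          · exact (ih c h (by omega)).1
          · exact hqi
    exact ⟨x, y, hx0, hrun, fun i => by rw [hwy, (hstep i i.2).2], hx⟩
  refine ⟨f, fun t₀ m m' hne => Set.disjoint_left.2 fun w hw hw' => ?_⟩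
  obtain ⟨x, y, hx0, hrun, hy, hx⟩ := key t₀ m w hw
  obtain ⟨x', y', hx0', hrun', hy', hx'⟩ := key t₀ m' w hw'
  -- Equal outputs and equal starting times give equal controls, which cancel.
  have hdiff (k : ℕ) (hk : k ≤ N) : x k - x' k = (P.A ^ k).mulVec (x₀ m - x₀ m') := by
    induction k with
    | zero => simp [hx0, hx0']
    | succ k ih =>
      have : (fun i : Fin (k + 1) => y (t₀ + i)) = fun i : Fin (k + 1) => y' (t₀ + i) := by
        ext1 i
        rw [hy ⟨i, by omega⟩, hy' ⟨i, by omega⟩]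
      rw [hx, hx', this, add_sub_add_right_eq_sub, ← Matrix.mulVec_sub, ih (by omega),
        Matrix.mulVec_mulVec, pow_succ']
  have h1 := hsep m m' hne
  rw [← Matrix.mulVec_sub, ← hdiff N le_rfl] at h1
  have h2 := norm_sub_le (x N) (x' N)
  have h3 := hφ t₀ x y hrun N
  have h4 := hφ t₀ x' y' hrun' N
  linarith

/-- For a rate `c` strictly between capacity and entropy and large `N`, the separated set has more
than `2 ^ (c * N)` points since it is a cover, but fewer since it is the message set of a code. -/
theorem linearEntropy_le_zeroErrorFeedbackCapacity {cc : CoderController 𝒳 𝒴 n p}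
    {P : LinearPlant n p} (hzero : (fun _ => 0) ∈ P.noise) {ch : CausalChannel 𝒳 𝒴 𝒵} {l : ℝ}
    (hl : 0 < l) (hunif : cc.IsUniform P ch l) (hbdd : cc.UniformlyBounded P ch l) :
    (linearEntropy P.A : EReal) ≤ ch.zeroErrorFeedbackCapacity := by
  have : Nonempty 𝒳 := ⟨cc.coder 0 (fun _ => 0)⟩
  obtain ⟨φ, hφ⟩ := hbdd
  -- The bound is raised to make the packing radius positive.
  have hφ' : ∀ (t₀ : ℕ) (x : ℕ → Fin n → ℝ) (y : ℕ → 𝒴),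
      cc.IsClosedLoopRun P ch l t₀ x y → ∀ k, ‖x k‖ ≤ max φ 1 :=
    fun t₀ x y h k => (hφ t₀ x y h k).trans (le_max_left _ _)
  have hr : 0 < 2 * max φ 1 := by positivity
  by_contra! hlt
  obtain ⟨c, hc, hch⟩ := EReal.lt_iff_exists_real_btwn.1 hlt
  rw [EReal.coe_lt_coe_iff] at hch
  obtain ⟨C, m, hC, hcard⟩ := le_card_cover P.A hl hr.le
  obtain ⟨N, hNlt, hN⟩ := ((eventually_const_mul_pow_lt_pow C m
    (Real.one_lt_rpow one_lt_two (sub_pos.2 hch))).and (Filter.eventually_gt_atTop 0)).exists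
  obtain ⟨T, hT, hsep, hcov⟩ := exists_separated_cover P.A hl.le hr N
  choose! x₀ hx₀ hx₀T using hT
  have hTpos : 0 < T.card := by
    obtain ⟨t, ht, -⟩ := hcov 0 (by simpa using hl.le)
    exact Finset.card_pos.2 ⟨t, ht⟩
  obtain ⟨f, hf⟩ := exists_zeroErrorCode_of_uniformlyBounded hzero hunif hφ' N
    (fun m => x₀ (T.equivFin.symm m)) (fun m => hx₀ _ (T.equivFin.symm m).2)
    (fun m m' hne => by
      rw [hx₀T _ (T.equivFin.symm m).2, hx₀T _ (T.equivFin.symm m').2]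
      exact hsep _ (T.equivFin.symm m).2 _ (T.equivFin.symm m').2
        fun h => hne (T.equivFin.symm.injective (Subtype.ext h)))
  have hle : ((Real.logb 2 (T.card : ℝ) / (N : ℝ) : ℝ) : EReal) ≤ ch.zeroErrorFeedbackCapacity :=
    le_sSup ⟨N, T.card, f, hN, hTpos, hf, rfl⟩
  have hlt' := hle.trans_lt hc
  have hN' : (0 : ℝ) < N := Nat.cast_pos.2 hN
  rw [EReal.coe_lt_coe_iff, div_lt_iff₀ hN',
    Real.logb_lt_iff_lt_rpow one_lt_two (Nat.cast_pos.2 hTpos), Real.rpow_mul two_pos.le,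
    Real.rpow_natCast] at hlt'
  have h1 := hcard N T hcov
  rw [Real.rpow_sub two_pos, div_pow, lt_div_iff₀ (by positivity)] at hNlt
  have h2 : C * (N + 1) ^ m * T.card < C * (N + 1) ^ m * ((2 : ℝ) ^ c) ^ N := by gcongr
  linarith

end CoderController

/-! ### Sufficiency: concatenation of codes. -/

namespace CausalChannel

variable {𝒳 𝒴 𝒵 : Type*}

/-- Uniform zero-error feedback codes can be concatenated. -/
theorem IsUniformZeroError.exists_pow {ch : CausalChannel 𝒳 𝒴 𝒵} {M n : ℕ} (hn : 0 < n)
    {f : FeedbackEncoder 𝒳 𝒴 M n} (hf : ch.IsUniformZeroError f) (r : ℕ) :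
    ∃ g : FeedbackEncoder 𝒳 𝒴 (M ^ r) (r * n), ch.IsUniformZeroError g := by
  -- Sub-block `i / n` carries one base-`M` digit of the message and uses the outputs of that
  -- sub-block only.
  let g : FeedbackEncoder 𝒳 𝒴 (M ^ r) (r * n) := fun i m w =>
    f ⟨i % n, Nat.mod_lt _ hn⟩
      (finFunctionFinEquiv.symm m ⟨i / n, (Nat.div_lt_iff_lt_mul hn).2 i.2⟩)
      (fun j => w ⟨i / n * n + j, by
        have h1 := Nat.div_add_mod' (i : ℕ) n
        have h2 : (j : ℕ) < i % n := j.2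
        omega⟩)
  have hg (t₀ : ℕ) (m : Fin (M ^ r)) (y : ℕ → 𝒴) (a : Fin r) (c : Fin n) (i : Fin (r * n))
      (hia : i / n = (a : ℕ)) (hic : i % n = (c : ℕ)) :
      g i m (fun j => y (t₀ + j)) =
        f c (finFunctionFinEquiv.symm m a) (fun j => y (t₀ + a * n + j)) := by
    obtain ⟨a, ha⟩ := a
    obtain ⟨c, hc⟩ := c
    subst hia hic
    simp only [g, add_assoc]
  refine ⟨g, fun t₀ m m' hne => Set.disjoint_left.2 fun w hw hw' => ?_⟩
  obtain ⟨a, ha⟩ : ∃ a, finFunctionFinEquiv.symm m a ≠ finFunctionFinEquiv.symm m' a := by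
    by_contra! h
    exact hne (finFunctionFinEquiv.symm.injective (funext h))
  have hlt (c : Fin n) : (a : ℕ) * n + c < r * n := by
    calc (a : ℕ) * n + c < a * n + n := by omega
      _ = (a + 1) * n := by ring
      _ ≤ r * n := Nat.mul_le_mul_right _ a.2
  -- Here the uniformity of `f` is essential: sub-block `a` is a transmission started at `t₀ + a *
  -- n` after arbitrary inputs.
  have hblock (m : Fin (M ^ r)) (hw : w ∈ ch.outputRange g t₀ m) :
      (fun c : Fin n => w ⟨a * n + c, hlt c⟩) ∈
        ch.outputRange f (t₀ + a * n) (finFunctionFinEquiv.symm m a) := by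
    obtain ⟨x, y, hrun, hx, hwy⟩ := hw
    refine ⟨x, y, hrun, fun c => ?_, fun c => ?_⟩
    · have h1 := hx ⟨a * n + c, hlt c⟩
      have h2 : ((a : ℕ) * n + c) / n = a := by
        rw [mul_comm, Nat.mul_add_div hn, Nat.div_eq_of_lt c.2, add_zero]
      have h3 : ((a : ℕ) * n + c) % n = c := by
        rw [mul_comm, Nat.mul_add_mod, Nat.mod_eq_of_lt c.2]
      rw [hg t₀ m y a c _ h2 h3] at h1
      rw [add_assoc]
      exact h1
    · rw [add_assoc]
      exact hwy _
  exact Set.disjoint_left.1 (hf (t₀ + a * n) _ _ ha) (hblock m hw) (hblock m' hw')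

end CausalChannel

/-! ### Steering of stabilizable systems. -/

section Stabilizable

variable {n p : ℕ}

/-- The span of the ranges of `A ^ k * B` for `k < N`, complexified. -/
noncomputable def reachableSubspace (A : Matrix (Fin n) (Fin n) ℝ)
    (B : Matrix (Fin n) (Fin p) ℝ) (N : ℕ) : Submodule ℂ (Fin n → ℂ) :=
  ⨆ k : Fin N, LinearMap.range ((A ^ (k : ℕ) * B).map Complex.ofReal).mulVecLin

theorem exists_controllableSubspace_le_reachableSubspace (A : Matrix (Fin n) (Fin n) ℝ)
    (B : Matrix (Fin n) (Fin p) ℝ) :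
    ∃ N₀, ∀ N ≥ N₀, controllableSubspace A B ≤ reachableSubspace A B N := by
  have hmono : Monotone (reachableSubspace A B) := by
    intro N N' h
    refine iSup_le fun k => ?_
    exact le_iSup (fun k : Fin N' =>
      LinearMap.range ((A ^ (k : ℕ) * B).map Complex.ofReal).mulVecLin) ⟨k, k.2.trans_le h⟩
  obtain ⟨N₀, hN₀⟩ := monotone_stabilizes_iff_noetherian.2
    (inferInstance : IsNoetherian ℂ (Fin n → ℂ)) ⟨_, hmono⟩
  refine ⟨N₀, fun N hN => iSup_le fun k => ?_⟩
  have h1 : LinearMap.range ((A ^ k * B).map Complex.ofReal).mulVecLin ≤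
      reachableSubspace A B (max N₀ (k + 1)) :=
    le_iSup (fun k : Fin (max N₀ (k + 1)) =>
      LinearMap.range ((A ^ (k : ℕ) * B).map Complex.ofReal).mulVecLin)
      ⟨k, lt_max_of_lt_right (Nat.lt_succ_self k)⟩
  refine h1.trans ?_
  have h2 : reachableSubspace A B N₀ = reachableSubspace A B (max N₀ (k + 1)) :=
    hN₀ _ (le_max_left _ _)
  rw [← h2]
  exact hmono hN

theorem exists_re_eq_sum_of_mem_reachableSubspace (A : Matrix (Fin n) (Fin n) ℝ)
    (B : Matrix (Fin n) (Fin p) ℝ) (N : ℕ) {w : Fin n → ℂ} (hw : w ∈ reachableSubspace A B N) :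
    ∃ u : Fin N → Fin p → ℝ,
      (fun i => (w i).re) = ∑ j : Fin N, (A ^ (N - 1 - (j : ℕ)) * B).mulVec (u j) := by
  refine Submodule.iSup_induction _
    (motive := fun w => ∃ u : Fin N → Fin p → ℝ,
      (fun i => (w i).re) = ∑ j : Fin N, (A ^ (N - 1 - (j : ℕ)) * B).mulVec (u j)) hw ?_ ?_ ?_
  · rintro k _ ⟨v, rfl⟩
    obtain ⟨x, y, rfl, -, -⟩ := exists_complexPoint_eq v
    -- A control applied at step `N - 1 - k` is propagated by `A ^ k`. Since `A` and `B` are real,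
    -- the real part of the complex control suffices.
    refine ⟨Pi.single ⟨N - 1 - k, by omega⟩ x, ?_⟩
    rw [Finset.sum_eq_single ⟨N - 1 - k, by omega⟩ (fun j _ hj => by simp [hj]) (by simp)]
    have hk : N - 1 - (N - 1 - (k : ℕ)) = k := by omega
    rw [Pi.single_eq_same, Matrix.mulVecLin_apply, map_ofReal_mulVec_complexPoint, hk]
    rfl
  · exact ⟨0, by simp; rfl⟩
  · rintro w w' ⟨u, hu⟩ ⟨u', hu'⟩
    refine ⟨u + u', ?_⟩
    simp only [Pi.add_apply, Matrix.mulVec_add, Finset.sum_add_distrib, ← hu, ← hu']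
    rfl

-- Unstable components stay in their generalized eigenspaces, which are controllable; stable
-- components decay to zero.
open Filter Topology in
theorem eventually_exists_mem_controllableSubspace {A : Matrix (Fin n) (Fin n) ℝ}
    {B : Matrix (Fin n) (Fin p) ℝ} (hstab : IsStabilizable A B) (v : Fin n → ℂ) :
    ∀ ε > 0, ∀ᶠ N : ℕ in atTop, ∃ w ∈ controllableSubspace A B,
      ‖((Matrix.toLin' (A.map Complex.ofReal)) ^ N) v - w‖ < ε := by
  set f : Module.End ℂ (Fin n → ℂ) := Matrix.toLin' (A.map Complex.ofReal)
  have hv : v ∈ ⨆ μ, f.maxGenEigenspace μ := by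
    rw [Module.End.iSup_maxGenEigenspace_eq_top]
    trivial
  refine Submodule.iSup_induction _ (motive := fun v => ∀ ε > 0, ∀ᶠ N : ℕ in atTop,
    ∃ w ∈ controllableSubspace A B, ‖(f ^ N) v - w‖ < ε) hv ?_ ?_ ?_
  · intro μ v hv ε hε
    by_cases hμ : 1 ≤ ‖μ‖
    · refine Eventually.of_forall fun N => ⟨(f ^ N) v, hstab μ hμ ?_, by simpa⟩
      exact f.mapsTo_maxGenEigenspace_of_comm ((Commute.refl f).pow_right N) μ hv
    · obtain ⟨ρ, hμρ, hρ⟩ := exists_between (not_le.1 hμ)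
      have hρ0 : 0 < ρ := (norm_nonneg μ).trans_lt hμρ
      obtain ⟨m, hm⟩ := (f.mem_maxGenEigenspace _ _).1 hv
      obtain ⟨C, hC, h⟩ := exists_norm_pow_apply_le f hρ0 hμρ.le m v
        (by rwa [Algebra.algebraMap_eq_smul_one])
      filter_upwards [eventually_const_mul_pow_lt_pow (C / ε) m ((one_lt_inv₀ hρ0).2 hρ)]
        with N hN
      refine ⟨0, zero_mem _, ?_⟩
      rw [sub_zero]
      refine (h N).trans_lt ?_
      rw [inv_pow, ← one_div, lt_div_iff₀ (by positivity)] at hN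
      calc C * (N + 1) ^ m * ρ ^ N = ε * (C / ε * (N + 1) ^ m * ρ ^ N) := by field_simp
        _ < ε := mul_lt_of_lt_one_right hε hN
  · intro ε hε
    exact Eventually.of_forall fun N => ⟨0, zero_mem _, by simpa⟩
  · intro v v' h h' ε hε
    filter_upwards [h (ε / 2) (by linarith), h' (ε / 2) (by linarith)] with N hN hN'
    obtain ⟨w, hw, hvw⟩ := hN
    obtain ⟨w', hw', hvw'⟩ := hN'
    refine ⟨w + w', add_mem hw hw', ?_⟩
    rw [map_add, add_sub_add_comm]
    exact (norm_add_le _ _).trans_lt (by linarith)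

open Filter in
/-- A stabilizable system can be steered to half the norm in any sufficiently long time, by
controls that are linear in the state. -/
theorem eventually_exists_contracting_gain {A : Matrix (Fin n) (Fin n) ℝ}
    {B : Matrix (Fin n) (Fin p) ℝ} (hstab : IsStabilizable A B) :
    ∀ᶠ N : ℕ in atTop, ∃ K : ℕ → Matrix (Fin p) (Fin n) ℝ, ∀ x : Fin n → ℝ,
      ‖(A ^ N).mulVec x +
        ∑ j ∈ Finset.range N, (A ^ (N - 1 - j) * B).mulVec ((K j).mulVec x)‖ ≤ 1 / 2 * ‖x‖ := by
  obtain ⟨N₀, hN₀⟩ := exists_controllableSubspace_le_reachableSubspace A B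
  -- The errors of the `n` unit vectors add up to at most `1 / 2`.
  have hε : (0 : ℝ) < 1 / (2 * (n + 1)) := by positivity
  have hall := eventually_all.2 fun i : Fin n =>
    eventually_exists_mem_controllableSubspace hstab (complexPoint (Pi.single i 1) 0) _ hε
  filter_upwards [hall, eventually_ge_atTop N₀] with N hN hN₀N
  have hu (i : Fin n) : ∃ u : Fin N → Fin p → ℝ, ‖(A ^ N).mulVec (Pi.single i 1) -
      ∑ j : Fin N, (A ^ (N - 1 - (j : ℕ)) * B).mulVec (u j)‖ ≤ 1 / (2 * (n + 1)) := by
    obtain ⟨w, hw, hlt⟩ := hN i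
    obtain ⟨u, hu⟩ := exists_re_eq_sum_of_mem_reachableSubspace A B N (hN₀ N hN₀N hw)
    refine ⟨u, le_trans ?_ hlt.le⟩
    rw [← hu, toLin'_map_ofReal_pow_complexPoint]
    exact norm_left_le_norm_complexPoint _ (fun i => _ - (w i).im)
  choose u hu using hu
  refine ⟨fun j => Matrix.of fun a i => if h : j < N then - u i ⟨j, h⟩ a else 0, fun x => ?_⟩
  have hK (j : Fin N) : (Matrix.of fun a i => if h : (j : ℕ) < N then - u i ⟨j, h⟩ a else 0).mulVec x
      = ∑ i, x i • (- u i j) := by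
    ext a
    simp [Matrix.mulVec, dotProduct, mul_comm]
  have hx : x = ∑ i, x i • (Pi.single i (1 : ℝ) : Fin n → ℝ) := by
    ext a
    simp [Pi.single_apply]
  have heq : (A ^ N).mulVec x + ∑ j ∈ Finset.range N, (A ^ (N - 1 - j) * B).mulVec
        ((Matrix.of fun a i => if h : j < N then - u i ⟨j, h⟩ a else 0).mulVec x) =
      ∑ i, x i • ((A ^ N).mulVec (Pi.single i 1) -
        ∑ j : Fin N, (A ^ (N - 1 - (j : ℕ)) * B).mulVec (u i j)) := by
    rw [Finset.sum_range]
    simp only [hK]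
    have hA : (A ^ N).mulVec x = ∑ i, x i • (A ^ N).mulVec (Pi.single i 1) := by
      conv_lhs => rw [hx]
      simp only [Matrix.mulVec_sum, Matrix.mulVec_smul]
    rw [hA]
    simp only [Matrix.mulVec_sum, Matrix.mulVec_smul, Matrix.mulVec_neg, smul_sub, smul_neg,
      Finset.sum_sub_distrib, Finset.smul_sum, Finset.sum_neg_distrib, ← sub_eq_add_neg]
    rw [Finset.sum_comm]
  rw [heq]
  calc _ ≤ ∑ i : Fin n, ‖x‖ * (1 / (2 * (n + 1))) := by
        refine norm_sum_le_of_le _ fun i _ => ?_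
        rw [norm_smul]
        exact mul_le_mul (norm_le_pi_norm x i) (hu i) (norm_nonneg _) (norm_nonneg _)
    _ = 1 / 2 * ‖x‖ * (n / (n + 1)) := by simp; field_simp
    _ ≤ 1 / 2 * ‖x‖ := mul_le_of_le_one_right (by positivity)
        ((div_le_one (by positivity)).2 (by linarith))

/-- Signalling needs `B ≠ 0`. If `B = 0`, nothing nonzero is controllable, although an unstable
eigenvalue has a nontrivial generalized eigenspace. -/
theorem exists_mulVec_ne_zero_of_isStabilizable {A : Matrix (Fin n) (Fin n) ℝ}
    {B : Matrix (Fin n) (Fin p) ℝ} (hstab : IsStabilizable A B)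
    (hunstable : ∃ z ∈ complexEigenvalues A, 1 < ‖z‖) : ∃ w, B.mulVec w ≠ 0 := by
  by_contra! h
  have hB : B = 0 := Matrix.ext_of_mulVec_single fun i => by rw [h, Matrix.zero_mulVec]
  obtain ⟨z, hz, hz1⟩ := hunstable
  have hbot : Module.End.maxGenEigenspace (Matrix.toLin' (A.map Complex.ofReal)) z = ⊥ := by
    refine eq_bot_iff.2 ((hstab z hz1.le).trans (iSup_le fun k => ?_))
    rintro _ ⟨v, rfl⟩
    simp [hB]
  rw [complexEigenvalues, ← Matrix.charpoly_toLin', ← Multiset.count_pos, Polynomial.count_roots,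
    ← LinearMap.finrank_maxGenEigenspace_eq, hbot, finrank_bot] at hz
  exact lt_irrefl _ hz

end Stabilizable

/-! ### Choice of code, quantizer and signals. -/

/-- If the cover of the image of the unit ball has at most `M` points, then there is a quantizer
with `M` cells. -/
theorem exists_quantizer {n : ℕ} (A : Matrix (Fin n) (Fin n) ℝ) (N M : ℕ)
    {T : Finset (Fin n → ℝ)} (hT : ∀ t ∈ T, ∃ x, ‖x‖ ≤ 1 ∧ (A ^ N).mulVec x = t) {r : ℝ}
    (hcov : ∀ x, ‖x‖ ≤ 1 → ∃ t ∈ T, ‖(A ^ N).mulVec x - t‖ ≤ r) (hM : T.card ≤ M) :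
    ∃ s : Fin M → Fin n → ℝ, (∀ m, ‖s m‖ ≤ 1) ∧
      ∀ x, ‖x‖ ≤ 1 → ∃ m, ‖(A ^ N).mulVec (x - s m)‖ ≤ r := by
  choose! x₀ hx₀ hx₀T using hT
  obtain ⟨t₀, ht₀, -⟩ := hcov 0 (by simp)
  have : Nonempty T := ⟨⟨t₀, ht₀⟩⟩
  obtain ⟨e⟩ : Nonempty (T ↪ Fin M) :=
    Function.Embedding.nonempty_of_card_le (by simpa using hM)
  refine ⟨fun m => x₀ (Function.invFun e m : T), fun m => hx₀ _ (Function.invFun e m : T).2,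
    fun x hx => ?_⟩
  obtain ⟨t, ht, hxt⟩ := hcov x hx
  refine ⟨e ⟨t, ht⟩, ?_⟩
  beta_reduce
  rw [Function.leftInverse_invFun e.injective, Matrix.mulVec_sub, hx₀T t ht]
  exact hxt

-- A code of rate above the entropy is repeated `r` times. For large `r` its message count dominates
-- the packing number, polynomial factor included, and the block is long enough for a contracting
-- gain.
open Filter in
theorem exists_code_quantizer_gain {n p : ℕ} {A : Matrix (Fin n) (Fin n) ℝ}
    {B : Matrix (Fin n) (Fin p) ℝ} (hstab : IsStabilizable A B) {𝒳 𝒴 𝒵 : Type*}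
    {ch : CausalChannel 𝒳 𝒴 𝒵} (hlt : (linearEntropy A : EReal) < ch.zeroErrorFeedbackCapacity) :
    ∃ (N M : ℕ) (f : CausalChannel.FeedbackEncoder 𝒳 𝒴 M N) (s : Fin M → Fin n → ℝ)
      (K : ℕ → Matrix (Fin p) (Fin n) ℝ), 0 < N ∧ 0 < M ∧ ch.IsUniformZeroError f ∧
      (∀ m, ‖s m‖ ≤ 1) ∧
      (∀ x, ‖x‖ ≤ 1 → ∃ m, ‖(A ^ N).mulVec (x - s m)‖ ≤ 1 / 2) ∧
      ∀ x : Fin n → ℝ, ‖(A ^ N).mulVec x +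
        ∑ j ∈ Finset.range N, (A ^ (N - 1 - j) * B).mulVec ((K j).mulVec x)‖ ≤ 1 / 2 * ‖x‖ := by
  obtain ⟨_, ⟨n₀, M₀, f₀, hn₀, hM₀, hf₀, rfl⟩, hR⟩ := lt_sSup_iff.1 hlt
  have hn₀' : (0 : ℝ) < n₀ := Nat.cast_pos.2 hn₀
  have hM₀' : (0 : ℝ) < M₀ := Nat.cast_pos.2 hM₀
  rw [EReal.coe_lt_coe_iff] at hR
  set R : ℝ := Real.logb 2 M₀ / n₀ with hRdef
  have hMR (r : ℕ) : ((2 : ℝ) ^ R) ^ (r * n₀) = ((M₀ ^ r : ℕ) : ℝ) := by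
    rw [mul_comm, pow_mul, ← Real.rpow_mul_natCast two_pos.le, hRdef, div_mul_cancel₀ _ hn₀'.ne',
      Real.rpow_logb two_pos (by norm_num) hM₀', Nat.cast_pow]
  obtain ⟨C, m, hC, hcard⟩ := card_separated_le A (l := 1) (r := 1 / 2) zero_le_one (by norm_num)
  have htend : Tendsto (fun r : ℕ => r * n₀) atTop atTop := tendsto_id.atTop_mul_const' hn₀
  obtain ⟨r, ⟨hr, hgain⟩, hr0⟩ := ((htend.eventually ((eventually_const_mul_pow_lt_pow C m
    (Real.one_lt_rpow one_lt_two (sub_pos.2 hR))).and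
      (eventually_exists_contracting_gain hstab))).and (eventually_gt_atTop 0)).exists
  obtain ⟨K, hK⟩ := hgain
  obtain ⟨T, hT, hsep, hcov⟩ := exists_separated_cover A (l := 1) (r := 1 / 2) zero_le_one
    (by norm_num) (r * n₀)
  obtain ⟨g, hg⟩ := hf₀.exists_pow hn₀ r
  have hTM : T.card ≤ M₀ ^ r := by
    rw [← Nat.cast_le (α := ℝ), ← hMR]
    refine (hcard _ T hT hsep).trans ?_
    rw [Real.rpow_sub two_pos, div_pow, lt_div_iff₀ (by positivity)] at hr
    exact hr.le
  obtain ⟨s, hs, hsx⟩ := exists_quantizer A (r * n₀) (M₀ ^ r) hT hcov hTM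
  exact ⟨r * n₀, M₀ ^ r, g, s, K, Nat.mul_pos hr0 hn₀, Nat.pow_pos hM₀, hg, hs, hsx, hK⟩

theorem Matrix.exists_norm_mulVec_le {m n : ℕ} (A : Matrix (Fin m) (Fin n) ℝ) :
    ∃ c : ℝ, 0 ≤ c ∧ ∀ x, ‖A.mulVec x‖ ≤ c * ‖x‖ :=
  ⟨‖A.mulVecLin.toContinuousLinearMap‖, norm_nonneg _, fun x =>
    A.mulVecLin.toContinuousLinearMap.le_opNorm x⟩

theorem Matrix.exists_norm_sum_mulVec_le {m n : ℕ} (N : ℕ) (A : ℕ → Matrix (Fin m) (Fin n) ℝ)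
    (r : ℝ) : ∃ c : ℝ, ∀ v : ℕ → Fin n → ℝ, (∀ j < N, ‖v j‖ ≤ r) →
      ‖∑ j ∈ Finset.range N, (A j).mulVec (v j)‖ ≤ c := by
  choose c hc h using fun j => (A j).exists_norm_mulVec_le
  refine ⟨∑ j ∈ Finset.range N, c j * r, fun v hv => norm_sum_le_of_le _ fun j hj => ?_⟩
  exact (h j (v j)).trans (mul_le_mul_of_nonneg_left (hv j (Finset.mem_range.1 hj)) (hc j))

theorem eq_pow_mulVec_add_sum {n : ℕ} (A : Matrix (Fin n) (Fin n) ℝ) {x w : ℕ → Fin n → ℝ}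
    (h : ∀ k, x (k + 1) = A.mulVec (x k) + w k) (k N : ℕ) :
    x (k + N) = (A ^ N).mulVec (x k) +
      ∑ j ∈ Finset.range N, (A ^ (N - 1 - j)).mulVec (w (k + j)) := by
  induction N with
  | zero => simp
  | succ N ih =>
    rw [← add_assoc, h, ih, Matrix.mulVec_add, Matrix.mulVec_mulVec, ← pow_succ',
      Finset.sum_range_succ, Matrix.mulVec_sum, add_assoc]
    congr 2
    · refine Finset.sum_congr rfl fun j hj => ?_
      rw [Finset.mem_range] at hj
      rw [Matrix.mulVec_mulVec, ← pow_succ']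
      congr 2
      omega
    · simp

/-- Finitely many signals can be encoded in the control so that they can be read from the next
state in spite of the plant noise. -/
theorem exists_signalling {S : Type*} [Finite S] [Nonempty S] {n p : ℕ}
    {B : Matrix (Fin n) (Fin p) ℝ} (hB : ∃ w, B.mulVec w ≠ 0) {D : ℝ} (hD : 0 ≤ D) :
    ∃ (σ : S → Fin p → ℝ) (read : (Fin n → ℝ) → S),
      ∀ a v, ‖v‖ ≤ D → read (B.mulVec (σ a) + v) = a := by
  classical
  obtain ⟨w, hw⟩ := hB
  obtain ⟨e, he⟩ := exists_injective_nat S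
  have hw' : 0 < ‖B.mulVec w‖ := norm_pos_iff.2 hw
  -- The images under `B` lie on a line with gaps of at least `2 * D + 1`, so their noise balls of
  -- radius `D` are disjoint.
  let σ : S → Fin p → ℝ := fun a => ((e a : ℝ) * ((2 * D + 1) / ‖B.mulVec w‖)) • w
  have hσ (a b : S) (h : ‖B.mulVec (σ a) - B.mulVec (σ b)‖ ≤ 2 * D) : a = b := by
    by_contra hne
    have h1 : (1 : ℝ) ≤ |(e a : ℝ) - e b| := by
      have : (e a : ℤ) - e b ≠ 0 := sub_ne_zero.2 fun h => hne (he (by exact_mod_cast h))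
      exact_mod_cast Int.one_le_abs this
    simp only [σ, Matrix.mulVec_smul, ← sub_smul, ← sub_mul, norm_smul, norm_mul, norm_div,
      Real.norm_eq_abs] at h
    rw [abs_of_pos hw', mul_assoc, div_mul_cancel₀ _ hw'.ne', abs_of_pos (by linarith : 0 < 2 * D + 1)] at h
    nlinarith
  refine ⟨σ, fun d => if h : ∃ a, ‖d - B.mulVec (σ a)‖ ≤ D then h.choose else
    Classical.arbitrary S, fun a v hv => ?_⟩
  have hex : ∃ b, ‖B.mulVec (σ a) + v - B.mulVec (σ b)‖ ≤ D := ⟨a, by simpa using hv⟩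
  beta_reduce
  rw [dif_pos hex]
  refine (hσ _ _ ?_).symm
  have h1 := hex.choose_spec
  have h2 := norm_sub_le (B.mulVec (σ a) + v - B.mulVec (σ hex.choose)) v
  rw [add_sub_right_comm, add_sub_cancel_right] at h2
  rw [add_sub_right_comm] at h1
  linarith

/-- The output ranges may vary with the starting time, so the decoder has to know it; this is the
only use the controller makes of `t₀`. -/
theorem CausalChannel.IsUniformZeroError.exists_decoder {𝒳 𝒴 𝒵 : Type*}
    {ch : CausalChannel 𝒳 𝒴 𝒵} {M n : ℕ} {f : CausalChannel.FeedbackEncoder 𝒳 𝒴 M n}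
    (hf : ch.IsUniformZeroError f) (hM : 0 < M) :
    ∃ dec : ℕ → (Fin n → 𝒴) → Fin M, ∀ t m, ∀ w ∈ ch.outputRange f t m, dec t w = m := by
  classical
  refine ⟨fun t w => if h : ∃ m, w ∈ ch.outputRange f t m then h.choose else ⟨0, hM⟩,
    fun t m w hw => ?_⟩
  have hex : ∃ m, w ∈ ch.outputRange f t m := ⟨m, hw⟩
  beta_reduce
  rw [dif_pos hex]
  by_contra hne
  exact Set.disjoint_left.1 (hf t _ _ hne) hex.choose_spec hw

/-! ### The block scheme. -/

/-- The sequence that starts with the given history and is constant afterwards. -/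
def extendHistory {α : Type*} {k : ℕ} (h : Fin (k + 1) → α) (j : ℕ) : α :=
  h ⟨min j k, by omega⟩

theorem extendHistory_restrict {α : Type*} (x : ℕ → α) {k j : ℕ} (hj : j ≤ k) :
    extendHistory (fun i : Fin (k + 1) => x i) j = x j := by
  simp [extendHistory, hj]

/-- A scheme that works in blocks of length `N`. In each block the coder sends the quantized
estimation error with the feedback code `f`. The feedback is provided by the controls, which
signal the next coding function. -/
structure BlockScheme (𝒳 𝒴 : Type*) (n p M N : ℕ) where
  A : Matrix (Fin n) (Fin n) ℝ
  B : Matrix (Fin n) (Fin p) ℝ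
  length_pos : 0 < N
  f : CausalChannel.FeedbackEncoder 𝒳 𝒴 M N
  point : Fin M → Fin n → ℝ
  quantize : (Fin n → ℝ) → Fin M
  decode : ℕ → (Fin N → 𝒴) → Fin M
  gain : ℕ → Matrix (Fin p) (Fin n) ℝ
  signal : (Fin M → 𝒳) → Fin p → ℝ
  readSignal : (Fin n → ℝ) → Fin M → 𝒳

namespace BlockScheme

variable {𝒳 𝒴 𝒵 : Type*} {n p M N : ℕ} (S : BlockScheme 𝒳 𝒴 n p M N)

/-- The predicted state at the end of a block, from the estimate `e` at its beginning, the message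
and the signals of the block. -/
def predict (e : Fin n → ℝ) (m : Fin M) (a : ℕ → Fin M → 𝒳) : Fin n → ℝ :=
  (S.A ^ N).mulVec (e + S.point m) + ∑ j ∈ Finset.range N,
    (S.A ^ (N - 1 - j) * S.B).mulVec ((S.gain j).mulVec e + S.signal (a j))

/-- The coding function of step `k`, given the previous outputs of its block. -/
def codingFunction (y : ℕ → 𝒴) (k : ℕ) : Fin M → 𝒳 := fun m =>
  S.f ⟨k % N, Nat.mod_lt _ S.length_pos⟩ m (fun j => y (k / N * N + j))

/-- The estimate of the controller at the beginning of block `b`. -/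
def controllerEstimate (t₀ : ℕ) (y : ℕ → 𝒴) : ℕ → Fin n → ℝ
  | 0 => 0
  | b + 1 => S.predict (controllerEstimate t₀ y b)
      (S.decode (t₀ + b * N) fun i => y (b * N + i))
      fun j => S.codingFunction y (b * N + j + 1)

/-- The signal of step `k`, as read by the coder from the state that follows. -/
def innovation (x : ℕ → Fin n → ℝ) (e : Fin n → ℝ) (k : ℕ) : Fin M → 𝒳 :=
  S.readSignal (x (k + 1) - S.A.mulVec (x k) - S.B.mulVec ((S.gain (k % N)).mulVec e))

/-- The coder's copy of the estimate of the controller at the beginning of block `b`. -/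
def coderEstimate (x : ℕ → Fin n → ℝ) : ℕ → Fin n → ℝ
  | 0 => 0
  | b + 1 => S.predict (coderEstimate x b) (S.quantize (x (b * N) - coderEstimate x b))
      fun j => S.innovation x (coderEstimate x b) (b * N + j)

/-- The coding function of step `k`, as known to the coder. -/
def coderFunction (x : ℕ → Fin n → ℝ) : ℕ → Fin M → 𝒳
  | 0 => fun m => S.f ⟨0, S.length_pos⟩ m Fin.elim0
  | k + 1 => S.innovation x (S.coderEstimate x (k / N)) k

/-- The channel input of step `k`. -/
def channelInput (x : ℕ → Fin n → ℝ) (k : ℕ) : 𝒳 :=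
  S.coderFunction x k (S.quantize (x (k / N * N) - S.coderEstimate x (k / N)))

/-- The control of step `k`, for a given estimate. -/
def control (e : Fin n → ℝ) (y : ℕ → 𝒴) (k : ℕ) : Fin p → ℝ :=
  (S.gain (k % N)).mulVec e + S.signal (S.codingFunction y (k + 1))

/-- The coder-controller of the scheme. -/
def coderController : CoderController 𝒳 𝒴 n p where
  coder k h := S.channelInput (extendHistory h) k
  controller t₀ k h :=
    S.control (S.controllerEstimate t₀ (extendHistory h) (k / N)) (extendHistory h) k

theorem codingFunction_congr {y y' : ℕ → 𝒴} {k : ℕ} (h : ∀ j < k, y j = y' j) :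
    S.codingFunction y k = S.codingFunction y' k := by
  unfold codingFunction
  ext1 m
  congr 1
  ext1 j
  refine h _ ?_
  have h1 := Nat.div_add_mod' k N
  have h2 : (j : ℕ) < k % N := j.2
  omega

theorem controllerEstimate_congr (t₀ : ℕ) {y y' : ℕ → 𝒴} {b : ℕ}
    (h : ∀ j ≤ b * N, y j = y' j) :
    S.controllerEstimate t₀ y b = S.controllerEstimate t₀ y' b := by
  induction b with
  | zero => rfl
  | succ b ih =>
    rw [Nat.succ_mul] at h
    simp only [controllerEstimate, predict]
    rw [ih fun j hj => h j (by omega)]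
    have hy : (fun i : Fin N => y (b * N + i)) = fun i : Fin N => y' (b * N + i) :=
      funext fun i => h _ (by omega)
    rw [hy]
    congr 1
    refine Finset.sum_congr rfl fun j hj => ?_
    rw [Finset.mem_range] at hj
    rw [S.codingFunction_congr fun i hi => h i (by omega)]

theorem coderEstimate_congr {x x' : ℕ → Fin n → ℝ} {b : ℕ} (h : ∀ j ≤ b * N, x j = x' j) :
    S.coderEstimate x b = S.coderEstimate x' b := by
  induction b with
  | zero => rfl
  | succ b ih =>
    rw [Nat.succ_mul] at h
    simp only [coderEstimate, predict]
    rw [ih fun j hj => h j (by omega), h (b * N) (by omega)]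
    congr 1
    refine Finset.sum_congr rfl fun j hj => ?_
    rw [Finset.mem_range] at hj
    simp only [innovation]
    rw [h (b * N + j) (by omega), h (b * N + j + 1) (by omega)]

theorem channelInput_congr {x x' : ℕ → Fin n → ℝ} {k : ℕ} (h : ∀ j ≤ k, x j = x' j) :
    S.channelInput x k = S.channelInput x' k := by
  have hk : k / N * N ≤ k := Nat.div_mul_le_self k N
  unfold channelInput
  rw [S.coderEstimate_congr fun j hj => h j (hj.trans hk), h _ hk]
  refine congrFun ?_ _
  cases k with
  | zero => rfl
  | succ k =>
    have hk : k / N * N ≤ k := Nat.div_mul_le_self k N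
    simp only [coderFunction, innovation]
    rw [S.coderEstimate_congr fun j hj => h j (by omega), h k (by omega), h (k + 1) le_rfl]

theorem coder_eq (x : ℕ → Fin n → ℝ) (k : ℕ) :
    S.coderController.coder k (fun i => x i) = S.channelInput x k :=
  S.channelInput_congr fun _ hj => extendHistory_restrict x hj

theorem controller_eq (t₀ : ℕ) (y : ℕ → 𝒴) (k : ℕ) :
    S.coderController.controller t₀ k (fun i => y i) =
      S.control (S.controllerEstimate t₀ y (k / N)) y k := by
  simp only [coderController, control]
  rw [S.controllerEstimate_congr t₀ fun j hj =>
      extendHistory_restrict y (hj.trans (Nat.div_mul_le_self k N)),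
    S.codingFunction_congr fun j hj => extendHistory_restrict y (Nat.lt_succ_iff.1 hj)]

theorem mul_add_div_of_lt {b j : ℕ} (hj : j < N) : (b * N + j) / N = b := by
  rw [mul_comm, Nat.mul_add_div (by omega), Nat.div_eq_of_lt hj, add_zero]

theorem mul_add_mod_of_lt {b j : ℕ} (hj : j < N) : (b * N + j) % N = j := by
  rw [mul_comm, Nat.mul_add_mod, Nat.mod_eq_of_lt hj]

theorem codingFunction_mul_add (y : ℕ → 𝒴) (b : ℕ) (i : Fin N) :
    S.codingFunction y (b * N + i) = fun m => S.f i m (fun j => y (b * N + j)) := by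
  have h (k : ℕ) (c : Fin N) (b : ℕ) (hc : k % N = c) (hb : k / N = b) :
      S.codingFunction y k = fun m => S.f c m (fun j => y (b * N + j)) := by
    obtain ⟨c, hc'⟩ := c
    subst hb
    dsimp only at hc
    subst hc
    rfl
  exact h _ i b (mul_add_mod_of_lt i.2) (mul_add_div_of_lt i.2)

/-! ### Closed-loop analysis of the block scheme. -/

section Run

variable {P : LinearPlant n p} {ch : CausalChannel 𝒳 𝒴 𝒵} {l D : ℝ}

theorem state_eq (hA : S.A = P.A) (hB : S.B = P.B) {t₀ : ℕ} {x : ℕ → Fin n → ℝ} {y : ℕ → 𝒴}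
    {v : ℕ → Fin n → ℝ}
    (hx : ∀ k, x (k + 1) = P.A.mulVec (x k) +
      P.B.mulVec (S.coderController.controller t₀ k (fun i => y (t₀ + i))) + v (t₀ + k))
    {k : ℕ} (h : S.controllerEstimate t₀ (fun i => y (t₀ + i)) (k / N) =
      S.coderEstimate x (k / N)) :
    x (k + 1) = S.A.mulVec (x k) + (S.B.mulVec (S.control (S.coderEstimate x (k / N))
      (fun i => y (t₀ + i)) k) + v (t₀ + k)) := by
  have h1 := S.controller_eq t₀ (fun i => y (t₀ + i)) k
  beta_reduce at h1
  rw [hx, h1, h, hA, hB, add_assoc]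

/-- The coder can read the signals of the controller. -/
theorem innovation_eq
    (hread : ∀ a v, ‖v‖ ≤ D → S.readSignal (S.B.mulVec (S.signal a) + v) = a)
    {x : ℕ → Fin n → ℝ} {y : ℕ → 𝒴} {e v : Fin n → ℝ} (hv : ‖v‖ ≤ D) {k : ℕ}
    (hx : x (k + 1) = S.A.mulVec (x k) + (S.B.mulVec (S.control e y k) + v)) :
    S.innovation x e k = S.codingFunction y (k + 1) := by
  have h : x (k + 1) - S.A.mulVec (x k) - S.B.mulVec ((S.gain (k % N)).mulVec e) =
      S.B.mulVec (S.signal (S.codingFunction y (k + 1))) + v := by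
    rw [hx, control, Matrix.mulVec_add]
    abel
  rw [innovation, h]
  exact hread _ _ hv

/-- The coder and the controller have the same estimates. -/
theorem controllerEstimate_eq_coderEstimate (hA : S.A = P.A) (hB : S.B = P.B)
    (hD : ∀ v ∈ P.noise, ∀ t, ‖v t‖ ≤ D)
    (hread : ∀ a v, ‖v‖ ≤ D → S.readSignal (S.B.mulVec (S.signal a) + v) = a)
    (hdec : ∀ t m, ∀ w ∈ ch.outputRange S.f t m, S.decode t w = m)
    {t₀ : ℕ} {x : ℕ → Fin n → ℝ} {y : ℕ → 𝒴}
    (hrun : S.coderController.IsClosedLoopRun P ch l t₀ x y) (b : ℕ) :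
    S.controllerEstimate t₀ (fun i => y (t₀ + i)) b = S.coderEstimate x b := by
  obtain ⟨-, v, hv, q, hch, hq, hx⟩ := hrun
  set y' : ℕ → 𝒴 := fun i => y (t₀ + i)
  have hq' (k : ℕ) : q (t₀ + k) = S.channelInput x k := by rw [hq, S.coder_eq]
  have hinn (k : ℕ) (h : S.controllerEstimate t₀ y' (k / N) = S.coderEstimate x (k / N)) :
      S.innovation x (S.coderEstimate x (k / N)) k = S.codingFunction y' (k + 1) :=
    S.innovation_eq hread (hD v hv _) (S.state_eq hA hB hx h)
  induction b using Nat.strong_induction_on with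
  | _ b ih =>
    cases b with
    | zero => rfl
    | succ b =>
      have hbN : 0 < N := S.length_pos
      -- The coding function of step `k + 1` is signalled at step `k`, in a block where the
      -- estimates are already known to agree. At step `0` no feedback is needed.
      have hcoder (k : ℕ) (hk : k < b * N + N) :
          S.coderFunction x k = S.codingFunction y' k := by
        cases k with
        | zero =>
          ext m
          simp only [coderFunction]
          have h := congrFun (S.codingFunction_mul_add y' 0 ⟨0, hbN⟩) m
          simp only [zero_mul, add_zero] at h
          rw [h]
          congr 1
          ext j
          exact j.elim0
        | succ k =>
          refine hinn k (ih _ ?_)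
          rw [Nat.div_lt_iff_lt_mul hbN, Nat.succ_mul]
          omega
      -- So block `b` is a genuine transmission of the quantized error by the code, started at `t₀ +
      -- b * N`, and it is decoded correctly.
      have hmem : (fun i : Fin N => y' (b * N + i)) ∈ ch.outputRange S.f (t₀ + b * N)
          (S.quantize (x (b * N) - S.coderEstimate x b)) := by
        refine ⟨q, y, hch, fun i => ?_, fun i => by simp only [y', add_assoc]⟩
        rw [add_assoc, hq', channelInput, hcoder _ (by omega), mul_add_div_of_lt i.2,
          S.codingFunction_mul_add]
        simp only [y', add_assoc]
      rw [controllerEstimate, coderEstimate, hdec _ _ _ hmem, ih b (Nat.lt_succ_self b)]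
      simp only [predict]
      congr 1
      refine Finset.sum_congr rfl fun j hj => ?_
      rw [Finset.mem_range] at hj
      have h := hinn (b * N + j)
      rw [mul_add_div_of_lt hj] at h
      rw [h (ih b (Nat.lt_succ_self b))]

/-- The coder's estimate equals the controller's, but is computed from the states alone, without
`t₀`. -/
theorem isUniform (hA : S.A = P.A) (hB : S.B = P.B)
    (hD : ∀ v ∈ P.noise, ∀ t, ‖v t‖ ≤ D)
    (hread : ∀ a v, ‖v‖ ≤ D → S.readSignal (S.B.mulVec (S.signal a) + v) = a)
    (hdec : ∀ t m, ∀ w ∈ ch.outputRange S.f t m, S.decode t w = m) :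
    S.coderController.IsUniform P ch l := by
  refine ⟨fun k hx hy => S.control (S.coderEstimate (extendHistory hx) (k / N))
    (extendHistory hy) k, fun t₀ x y hrun k => ?_⟩
  have h := S.controller_eq t₀ (fun i => y (t₀ + i)) k
  beta_reduce at h
  rw [h, S.controllerEstimate_eq_coderEstimate hA hB hD hread hdec hrun]
  simp only [control]
  rw [S.coderEstimate_congr fun j hj =>
      extendHistory_restrict x (hj.trans (Nat.div_mul_le_self k N)),
    S.codingFunction_congr (y := extendHistory _) fun j hj =>
      extendHistory_restrict (fun i => y (t₀ + i)) (Nat.lt_succ_iff.1 hj)]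

/-- At block starts the error stays below `R` and the estimate below `Z`; within the `N` steps of a
block the state grows at most affinely per step. -/
theorem uniformlyBounded [Finite 𝒳] (hA : S.A = P.A) (hB : S.B = P.B)
    (hD : ∀ v ∈ P.noise, ∀ t, ‖v t‖ ≤ D)
    (hread : ∀ a v, ‖v‖ ≤ D → S.readSignal (S.B.mulVec (S.signal a) + v) = a)
    (hdec : ∀ t m, ∀ w ∈ ch.outputRange S.f t m, S.decode t w = m)
    {R : ℝ} (hlR : l ≤ R)
    (hnoise : ∀ v : ℕ → Fin n → ℝ, (∀ j < N, ‖v j‖ ≤ D) →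
      ‖∑ j ∈ Finset.range N, (S.A ^ (N - 1 - j)).mulVec (v j)‖ ≤ R / 2)
    (hpoint : ∀ m, ‖S.point m‖ ≤ R)
    (hquant : ∀ e, ‖e‖ ≤ R → ‖(S.A ^ N).mulVec (e - S.point (S.quantize e))‖ ≤ R / 2)
    (hgain : ∀ x : Fin n → ℝ, ‖(S.A ^ N).mulVec x + ∑ j ∈ Finset.range N,
      (S.A ^ (N - 1 - j) * S.B).mulVec ((S.gain j).mulVec x)‖ ≤ 1 / 2 * ‖x‖) :
    S.coderController.UniformlyBounded P ch l := by
  obtain ⟨cσ, hcσ⟩ : ∃ c : ℝ, ∀ a, ‖S.signal a‖ ≤ c := by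
    obtain ⟨c, hc⟩ := (Set.finite_range fun a => ‖S.signal a‖).bddAbove
    exact ⟨c, fun a => hc ⟨a, rfl⟩⟩
  obtain ⟨cA, hcA0, hcA⟩ := S.A.exists_norm_mulVec_le
  obtain ⟨cB, hcB0, hcB⟩ := S.B.exists_norm_mulVec_le
  obtain ⟨cAN, hcAN0, hcAN⟩ := (S.A ^ N).exists_norm_mulVec_le
  obtain ⟨cS, hcS⟩ := Matrix.exists_norm_sum_mulVec_le N (fun j => S.A ^ (N - 1 - j) * S.B) cσ
  choose cK hcK0 hcK using fun j => (S.gain j).exists_norm_mulVec_le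
  -- The fixed point of `z ↦ z / 2 + cAN * R + cS`, which bounds the update of the estimate.
  set Z : ℝ := 2 * (cAN * R + cS) with hZ
  set U : ℝ := cB * (∑ j ∈ Finset.range N, cK j * Z + cσ) + D with hU
  let g : ℕ → ℝ := fun i => Nat.rec (R + Z) (fun _ a => cA * a + U) i
  have hbN : 0 < N := S.length_pos
  refine ⟨∑ i ∈ Finset.range N, |g i|, fun t₀ x y hrun k => ?_⟩
  have hest := S.controllerEstimate_eq_coderEstimate hA hB hD hread hdec hrun
  obtain ⟨hx0, v, hv, q, hch, hq, hx⟩ := hrun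
  set y' : ℕ → 𝒴 := fun i => y (t₀ + i)
  have hx' (k : ℕ) := S.state_eq hA hB hx (hest (k / N))
  have hZ0 : 0 ≤ Z := by
    have h1 : 0 ≤ R := (norm_nonneg _).trans (hx0.trans hlR)
    have h2 : 0 ≤ cS := (norm_nonneg _).trans
      (hcS (fun _ => S.signal (S.codingFunction y' 0)) fun _ _ => hcσ _)
    positivity
  have hpred (b : ℕ) : S.coderEstimate x (b + 1) = S.predict (S.coderEstimate x b)
      (S.quantize (x (b * N) - S.coderEstimate x b))
      fun j => S.codingFunction y' (b * N + j + 1) := by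
    simp only [coderEstimate, predict]
    congr 1
    refine Finset.sum_congr rfl fun j hj => ?_
    rw [Finset.mem_range] at hj
    have h := S.innovation_eq hread (hD v hv _) (hx' (b * N + j))
    rw [mul_add_div_of_lt hj] at h
    rw [h]
  have hZb (b : ℕ) : ‖S.coderEstimate x b‖ ≤ Z := by
    induction b with
    | zero => simpa [coderEstimate] using hZ0
    | succ b ih =>
      set e := S.coderEstimate x b
      rw [hpred, predict]
      simp only [Matrix.mulVec_add, Finset.sum_add_distrib]
      rw [add_add_add_comm]
      refine (norm_add_le _ _).trans ?_
      have h1 := hgain e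
      have h2 := norm_add_le ((S.A ^ N).mulVec (S.point (S.quantize (x (b * N) - e))))
        (∑ j ∈ Finset.range N, (S.A ^ (N - 1 - j) * S.B).mulVec
          (S.signal (S.codingFunction y' (b * N + j + 1))))
      have h3 := hcS (fun j => S.signal (S.codingFunction y' (b * N + j + 1))) fun _ _ => hcσ _
      have h4 := (hcAN (S.point (S.quantize (x (b * N) - e)))).trans
        (mul_le_mul_of_nonneg_left (hpoint _) hcAN0)
      beta_reduce at h3
      linarith
  have herr (b : ℕ) : ‖x (b * N) - S.coderEstimate x b‖ ≤ R := by
    induction b with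
    | zero => simpa [coderEstimate] using hx0.trans hlR
    | succ b ih =>
      -- Gains and signals act identically on state and prediction; only quantization error and
      -- plant noise remain.
      have h1 : x ((b + 1) * N) - S.coderEstimate x (b + 1) =
          (S.A ^ N).mulVec (x (b * N) - S.coderEstimate x b -
            S.point (S.quantize (x (b * N) - S.coderEstimate x b))) +
          ∑ j ∈ Finset.range N, (S.A ^ (N - 1 - j)).mulVec (v (t₀ + (b * N + j))) := by
        rw [Nat.succ_mul, eq_pow_mulVec_add_sum S.A hx' (b * N) N, hpred, predict]
        have h2 : ∑ j ∈ Finset.range N, (S.A ^ (N - 1 - j)).mulVec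
            (S.B.mulVec (S.control (S.coderEstimate x ((b * N + j) / N)) y' (b * N + j)) +
              v (t₀ + (b * N + j))) =
            ∑ j ∈ Finset.range N, (S.A ^ (N - 1 - j) * S.B).mulVec
              ((S.gain j).mulVec (S.coderEstimate x b) +
                S.signal (S.codingFunction y' (b * N + j + 1))) +
            ∑ j ∈ Finset.range N, (S.A ^ (N - 1 - j)).mulVec (v (t₀ + (b * N + j))) := by
          rw [← Finset.sum_add_distrib]
          refine Finset.sum_congr rfl fun j hj => ?_
          rw [Finset.mem_range] at hj
          rw [mul_add_div_of_lt hj, control, mul_add_mod_of_lt hj, Matrix.mulVec_add,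
            Matrix.mulVec_mulVec]
        rw [h2]
        simp only [Matrix.mulVec_sub, Matrix.mulVec_add]
        abel
      rw [h1]
      have h2 := hquant _ ih
      have h3 := hnoise (fun j => v (t₀ + (b * N + j))) fun _ _ => hD v hv _
      refine (norm_add_le _ _).trans ?_
      beta_reduce at h3
      linarith
  have hblock (b i : ℕ) (hi : i < N) : ‖x (b * N + i)‖ ≤ g i := by
    induction i with
    | zero =>
      have h1 := norm_add_le (x (b * N) - S.coderEstimate x b) (S.coderEstimate x b)
      rw [sub_add_cancel] at h1
      exact h1.trans (add_le_add (herr b) (hZb b))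
    | succ i ih =>
      have hi' : i < N := by omega
      rw [← add_assoc, hx', mul_add_div_of_lt hi', control, mul_add_mod_of_lt hi']
      have h1 := (hcA (x (b * N + i))).trans (mul_le_mul_of_nonneg_left (ih hi') hcA0)
      have h2 : ‖(S.gain i).mulVec (S.coderEstimate x b)‖ ≤ ∑ j ∈ Finset.range N, cK j * Z :=
        ((hcK i _).trans (mul_le_mul_of_nonneg_left (hZb b) (hcK0 i))).trans
          (Finset.single_le_sum (f := fun j => cK j * Z)
            (fun j _ => mul_nonneg (hcK0 j) hZ0) (Finset.mem_range.2 hi'))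
      have h3 := (norm_add_le ((S.gain i).mulVec (S.coderEstimate x b))
        (S.signal (S.codingFunction y' (b * N + i + 1)))).trans (add_le_add h2 (hcσ _))
      have h4 := (hcB _).trans (mul_le_mul_of_nonneg_left h3 hcB0)
      exact (norm_add_le _ _).trans (add_le_add h1 ((norm_add_le _ _).trans
        (add_le_add h4 (hD v hv _))))
  have h := hblock (k / N) (k % N) (Nat.mod_lt _ hbN)
  rw [Nat.div_add_mod'] at h
  exact (h.trans (le_abs_self _)).trans (Finset.single_le_sum (f := fun i => |g i|)
    (fun i _ => abs_nonneg _) (Finset.mem_range.2 (Nat.mod_lt _ hbN)))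

end Run

end BlockScheme

/-! ### Assembly of the scheme and the main theorem. -/

theorem exists_coderController_of_linearEntropy_lt {n p : ℕ} {P : LinearPlant n p} {D : ℝ}
    (hD : ∀ v ∈ P.noise, ∀ t, ‖v t‖ ≤ D) (hD0 : 0 ≤ D)
    (hunstable : ∃ z ∈ complexEigenvalues P.A, 1 < ‖z‖) (hstab : IsStabilizable P.A P.B)
    {𝒳 𝒴 𝒵 : Type*} [Finite 𝒳] {ch : CausalChannel 𝒳 𝒴 𝒵} {l : ℝ}
    (hlt : (linearEntropy P.A : EReal) < ch.zeroErrorFeedbackCapacity) :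
    ∃ cc : CoderController 𝒳 𝒴 n p, cc.IsUniform P ch l ∧ cc.UniformlyBounded P ch l := by
  obtain ⟨N, M, f, s, K, hN, hM, hf, hs, hquant, hK⟩ := exists_code_quantizer_gain hstab hlt
  have : Nonempty (Fin M → 𝒳) := ⟨fun m => f ⟨0, hN⟩ m Fin.elim0⟩
  obtain ⟨σ, read, hread⟩ := exists_signalling (S := Fin M → 𝒳)
    (exists_mulVec_ne_zero_of_isStabilizable hstab hunstable) hD0
  obtain ⟨dec, hdec⟩ := hf.exists_decoder hM
  obtain ⟨c, hc⟩ := Matrix.exists_norm_sum_mulVec_le N (fun j => P.A ^ (N - 1 - j)) D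
  -- Positive, at least the initial error `l`, and such that the noise accumulated over a block is
  -- at most `R / 2`.
  set R : ℝ := max 1 (max l (2 * c)) with hRdef
  have hR : 0 < R := lt_max_of_lt_left one_pos
  have hRc : 2 * c ≤ R := (le_max_right _ _).trans (le_max_right _ _)
  -- The quantizer of the unit ball is rescaled by `R`; outside that ball the message is arbitrary.
  have hquant' (e : Fin n → ℝ) : ∃ m, ‖e‖ ≤ R →
      ‖(P.A ^ N).mulVec (e - R • s m)‖ ≤ R / 2 := by
    by_cases he : ‖e‖ ≤ R
    · obtain ⟨m, hm⟩ := hquant (R⁻¹ • e) (by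
        rw [norm_smul, norm_inv, Real.norm_of_nonneg hR.le]
        exact inv_mul_le_one_of_le₀ he hR.le)
      refine ⟨m, fun _ => ?_⟩
      have h1 : e - R • s m = R • (R⁻¹ • e - s m) := by
        rw [smul_sub, smul_inv_smul₀ hR.ne']
      rw [h1, Matrix.mulVec_smul, norm_smul, Real.norm_of_nonneg hR.le, div_eq_mul_one_div]
      exact mul_le_mul_of_nonneg_left hm hR.le
    · exact ⟨⟨0, hM⟩, fun h => (he h).elim⟩
  choose Q hQ using hquant'
  let S : BlockScheme 𝒳 𝒴 n p M N :=
    { A := P.A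
      B := P.B
      length_pos := hN
      f := f
      point := fun m => R • s m
      quantize := Q
      decode := dec
      gain := K
      signal := σ
      readSignal := read }
  refine ⟨S.coderController, S.isUniform rfl rfl hD hread hdec,
    S.uniformlyBounded rfl rfl hD hread hdec (R := R)
      ((le_max_left _ _).trans (le_max_right _ _)) (fun v hv => ?_) (fun m => ?_) hQ hK⟩
  · have := hc v hv
    change ‖∑ j ∈ Finset.range N, (P.A ^ (N - 1 - j)).mulVec (v j)‖ ≤ R / 2
    linarith
  · change ‖R • s m‖ ≤ R
    rw [norm_smul, Real.norm_of_nonneg hR.le]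
    exact mul_le_of_le_one_right hR.le (hs m)

theorem theorem2 {n p : ℕ} (P : LinearPlant n p) (D : ℝ)
    (hD : ∀ v ∈ P.noise, ∀ t, ‖v t‖ ≤ D)
    (hzero : (fun _ => 0) ∈ P.noise)
    (hunstable : ∃ z ∈ complexEigenvalues P.A, 1 < ‖z‖)
    (hstab : IsStabilizable P.A P.B)
    {𝒳 𝒴 𝒵 : Type*} [Finite 𝒳] (ch : CausalChannel 𝒳 𝒴 𝒵)
    (l : ℝ) (hl : 0 < l) :
    (∀ cc : CoderController 𝒳 𝒴 n p, cc.IsUniform P ch l → cc.UniformlyBounded P ch l →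
      (linearEntropy P.A : EReal) ≤ ch.zeroErrorFeedbackCapacity) ∧
    ((linearEntropy P.A : EReal) < ch.zeroErrorFeedbackCapacity →
      ∃ cc : CoderController 𝒳 𝒴 n p, cc.IsUniform P ch l ∧ cc.UniformlyBounded P ch l) := by
  have hD0 : 0 ≤ D := (norm_nonneg _).trans (hD _ hzero 0)
  exact ⟨fun cc hunif hbdd =>
      CoderController.linearEntropy_le_zeroErrorFeedbackCapacity hzero hl hunif hbdd,
    exists_coderController_of_linearEntropy_lt hD hD0 hunstable hstab⟩
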